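/- All graphs are simple, $d$ is the graph distance, and a set $Y$ of vertices of a connected graph $X$ is *gated* if for every vertex $x$ there is some $z \in Y$ with $d(x,y)=d(x,z)+d(z,y)$ for all $y\in Y$; the *gated hull* of a set is the intersection of all gated sets containing it. A *median triangle* of $(x_1,x_2,x_3)$ is a triple $(y_1,y_2,y_3)$ of vertices with $d(x_i,x_j)=d(x_i,y_i)+d(y_i,y_j)+d(y_j,x_j)$ for all $i\neq j$; its *size* is $d(y_1,y_2)+d(y_2,y_3)+d(y_3,y_1)$. A connected graph is *quasi-median* if any three vertices have a unique median triangle of minimal size and the gated hull of this triangle induces a (Cartesian) product of complete graphs, which may be infinite. A *hyperplane* is a class of edges for the equivalence relation generated by identifying two edges that lie in a common $3$-cycle or are opposite sides of a $4$-cycle. Two distinct hyperplanes are *transverse* if they contain the two distinct pairs of opposite sides of some $4$-cycle. The *sectors* delimited by a hyperplane $J$ are the connected components of the graph obtained from $X$ by removing the edges in $J$. If a group acts on $X$ by graph automorphisms, the *rotative-stabiliser* $\mathrm{stab}_\circlearrowright(J)$ is the intersection of the setwise stabilisers of all cliques (maximal complete subgraphs) whose edges are in $J$. The right-angled Artin group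 of a graph $\Gamma$ is $A(\Gamma)=\langle u\in V(\Gamma)\mid [u,v]=1,\ \{u,v\}\in E(\Gamma)\rangle$. **Proposition.** Let $G$ be a group acting by automorphisms on a quasi-median graph $X$ and let $\mathcal{J}$ be a finite set of hyperplanes of $X$. Assume that: - vertex-stabilisers are trivial; - for every $J\in\mathcal{J}$ we are given a non-trivial element $r_J\in\mathrm{stab}_\circlearrowright(J)$ that permutes freely the sectors delimited by $J$, in the sense that the induced $\mathbb{Z}$-action is free: $r_J^k S\neq S$ for every sector $S$ delimited by $J$ and every integer $k\neq 0$ (in particular $r_J$ has infinite order). Then there exists $N\geq 1$ such that, for every $n\geq N$, the subgroup $H:=\langle r_J^n \mid J\in\mathcal{J}\rangle$ of $G$ is a right-angled Artin group. More precisely, if $\mathscr{C}\mathcal{J}$ is the crossing graph of $\mathcal{J}$, i.e. the graph with vertex-set $\mathcal{J}$ in which two distinct hyperplanes are adjacent exactly when they are transverse, then the map $J\mapsto r_J^n$ induces an isomorphism $A(\mathscr{C}\mathcal{J})\to H$. -/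

import Mathlib

universe u v

namespace QM

section Graphs

/-- The Cartesian product of a family of graphs: two vertices are adjacent if they differ in
exactly one coordinate, where they are adjacent. -/
def cartesianProduct {ι : Type v} {K : ι → Type u} (Γ : ∀ i, SimpleGraph (K i)) :
    SimpleGraph (∀ i, K i) where
  Adj f g := ∃ i, (Γ i).Adj (f i) (g i) ∧ ∀ j, j ≠ i → f j = g j
  symm := ⟨fun _ _ ⟨i, h, h'⟩ => ⟨i, h.symm, fun j hj => (h' j hj).symm⟩⟩
  loopless := ⟨fun _ ⟨i, h, _⟩ => (Γ i).irrefl h⟩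

/-- A graph that is isomorphic to a finite Cartesian product of complete graphs, which may be
infinite. (For a connected graph, as below, finitely many factors is no restriction.) -/
def IsProductOfCompleteGraphs {W : Type u} (Y : SimpleGraph W) : Prop :=
  ∃ (n : ℕ) (K : Fin n → Type u),
    Nonempty (Y ≃g cartesianProduct (fun i => (⊤ : SimpleGraph (K i))))

variable {V : Type u} (X : SimpleGraph V)

/-- A set `Y` of vertices of a connected graph is gated if every vertex `x` has a gate `z ∈ Y`:
for every `y ∈ Y`, the vertex `z` lies on a geodesic from `x` to `y`. -/
def IsGated (Y : Set V) : Prop :=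
  ∀ x, ∃ z ∈ Y, ∀ y ∈ Y, X.dist x y = X.dist x z + X.dist z y

/-- The gated hull of a set of vertices: the intersection of all gated sets containing it. -/
def gatedHull (S : Set V) : Set V := ⋂₀ {Y | IsGated X Y ∧ S ⊆ Y}

/-- `y` is a median triangle of the three vertices `x 0, x 1, x 2`. -/
def IsMedianTriangle (x y : Fin 3 → V) : Prop :=
  ∀ i j, i ≠ j →
    X.dist (x i) (x j) = X.dist (x i) (y i) + X.dist (y i) (y j) + X.dist (y j) (x j)

/-- The size of a triangle. -/
noncomputable def triangleSize (y : Fin 3 → V) : ℕ :=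
  X.dist (y 0) (y 1) + X.dist (y 1) (y 2) + X.dist (y 2) (y 0)

/-- `y` is a median triangle of `x` of minimal size. -/
def IsMinimalMedianTriangle (x y : Fin 3 → V) : Prop :=
  IsMedianTriangle X x y ∧
    ∀ y', IsMedianTriangle X x y' → triangleSize X y ≤ triangleSize X y'

/-- Quasi-median graphs: connected graphs in which any three vertices have a unique median triangle
of minimal size, the gated hull of which is a product of complete graphs. -/
structure IsQuasiMedian : Prop where
  connected : X.Connected
  existsUnique_minimal : ∀ x : Fin 3 → V, ∃! y, IsMinimalMedianTriangle X x y
  hull_product : ∀ x y : Fin 3 → V, IsMinimalMedianTriangle X x y →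
    IsProductOfCompleteGraphs (X.induce (gatedHull X (Set.range y)))

end Graphs

section Hyperplanes

variable {V : Type u} (X : SimpleGraph V)

/-- The vertices `a, b, c, d` form, in this cyclic order, a 4-cycle. -/
def IsFourCycle (a b c d : V) : Prop :=
  X.Adj a b ∧ X.Adj b c ∧ X.Adj c d ∧ X.Adj d a ∧ a ≠ c ∧ b ≠ d

/-- Two edges that belong to a common 3-cycle, or that are opposite sides of a 4-cycle. -/
inductive ElemParallel : Sym2 V → Sym2 V → Prop
  | triangle (a b c : V) (hab : X.Adj a b) (hbc : X.Adj b c) (hca : X.Adj c a) :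
      ElemParallel s(a, b) s(a, c)
  | square (a b c d : V) (h : IsFourCycle X a b c d) :
      ElemParallel s(a, b) s(c, d)

/-- A hyperplane: a class of edges for the equivalence relation generated by `ElemParallel`. -/
def IsHyperplane (J : Set (Sym2 V)) : Prop :=
  ∃ e ∈ X.edgeSet, J = {f | f ∈ X.edgeSet ∧ Relation.EqvGen (ElemParallel X) e f}

/-- The hyperplanes of a graph. -/
abbrev Hyperplane : Type u := {J : Set (Sym2 V) // IsHyperplane X J}

variable {X}

/-- Two hyperplanes are transverse if they contain two distinct pairs of opposite sides of some
4-cycle. -/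
def Transverse (J K : Hyperplane X) : Prop :=
  ∃ a b c d, IsFourCycle X a b c d ∧
    s(a, b) ∈ J.1 ∧ s(c, d) ∈ J.1 ∧ s(b, c) ∈ K.1 ∧ s(d, a) ∈ K.1

theorem Transverse.symm {J K : Hyperplane X} : Transverse J K → Transverse K J := by
  rintro ⟨a, b, c, d, ⟨hab, hbc, hcd, hda, hac, hbd⟩, h1, h2, h3, h4⟩
  exact ⟨b, c, d, a, ⟨hbc, hcd, hda, hab, hbd, hac.symm⟩, h3, h4, h2, h1⟩

/-- The crossing graph of a set of hyperplanes: vertices are the hyperplanes of the set, and two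
(distinct) ones are adjacent if they are transverse. -/
def crossingGraph (𝒥 : Set (Hyperplane X)) : SimpleGraph 𝒥 where
  Adj J K := J ≠ K ∧ Transverse J.1 K.1
  symm := ⟨fun _ _ h => ⟨h.1.symm, h.2.symm⟩⟩
  loopless := ⟨fun _ h => h.1 rfl⟩

/-- The sectors delimited by `J`: the (vertex sets of the) connected components of the graph
obtained by removing the edges in `J`. -/
def sectors (J : Hyperplane X) : Set (Set V) :=
  {S | ∃ C : (X.deleteEdges J.1).ConnectedComponent, S = C.supp}

/-- The cliques in `J`: the maximal complete subgraphs (with at least one edge) all of whose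
edges are in `J`. -/
def cliquesIn (J : Hyperplane X) : Set (Set V) :=
  {C | Maximal X.IsClique C ∧ C.Nontrivial ∧ ∀ x ∈ C, ∀ y ∈ C, x ≠ y → s(x, y) ∈ J.1}

open scoped Pointwise in
/-- The rotative-stabiliser of `J`: the intersection of the (setwise) stabilisers of the cliques
in `J`. -/
def rotativeStabilizer (G : Type v) [Group G] [MulAction G V] (J : Hyperplane X) : Subgroup G :=
  ⨅ C ∈ cliquesIn J, MulAction.stabilizer G C

open scoped Pointwise in
/-- `r` permutes freely the sectors delimited by `J`: the `ℤ`-action `k ↦ r ^ k` on the sectors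
is free, i.e. no power of `r` with non-zero exponent fixes a sector. -/
def PermutesSectorsFreely {G : Type v} [Group G] [MulAction G V] (J : Hyperplane X) (r : G) :
    Prop :=
  ∀ k : ℤ, k ≠ 0 → ∀ S ∈ sectors J, r ^ k • S ≠ S

end Hyperplanes

section RAAG

variable {W : Type u}

/-- The relators `[u, v]`, for `u` and `v` adjacent in `Γ`. -/
def raagRelators (Γ : SimpleGraph W) : Set (FreeGroup W) :=
  {w | ∃ u v, Γ.Adj u v ∧ w =
    FreeGroup.of u * FreeGroup.of v * (FreeGroup.of u)⁻¹ * (FreeGroup.of v)⁻¹}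

/-- The right-angled Artin group of a graph. -/
abbrev RAAG (Γ : SimpleGraph W) : Type u := PresentedGroup (raagRelators Γ)

/-- The generator of the right-angled Artin group given by a vertex. -/
def RAAG.of (Γ : SimpleGraph W) (w : W) : RAAG Γ := PresentedGroup.of w

end RAAG

end QM

/-!
Two elements of the group that are attached to transverse hyperplanes commute, and large powers of
the others play ping-pong on the vertices.

The geometry is reduced to local conditions. The gated hull of a minimal median triangle is convex,
so its intrinsic metric, which is a Hamming metric, is the restriction of the metric of the graph
(`isHammingSet_gatedHull`). This gives the triangle and quadrangle conditions and excludes `K₄`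
minus an edge and `K_{2,3}` as induced subgraphs. It follows that on an induced square `a b c d`
the distances to any vertex `u` satisfy `d(u,a) + d(u,c) = d(u,b) + d(u,d)`
(`IsQuasiMedian.dist_square`), and that every vertex has a gate in every maximal clique `C`.
Having ends with distinct gates in `C` is therefore invariant under elementary parallelism of edges,
so the edges of the hyperplane of `C` all have this property, and a geodesic from a vertex to its
gate does not cross the hyperplane: every sector meets `C`
(`Hyperplane.exists_sameSector_mem_clique`).

Let `J` and `K` be distinct. If they are transverse, some clique of `K` is contained in the carrier
of `J`, and a rotation around `J` moves each of its vertices along an edge of `J`, hence inside a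
sector of `K`; so it fixes every sector of `K`. Since vertex-stabilisers are trivial and there is
no `K_{2,3}`, rotations around `J` and `K` commute. If they are not transverse, `K` lies in one
sector of `J`, and so does every sector of `K` that does not contain `J`
(`Hyperplane.sameSector_of_not_sameSector`).

Now let `P` be a finite set of vertices containing a base point and one point in the carrier of each
hyperplane of the family, and let `Y J` be the union of the sectors of `J` that contain no point of
`P`. As the rotation acts freely on sectors, for large `n` the nontrivial powers of `r J ^ n` send
every sector of `J` meeting `P` into `Y J`. These sets satisfy the ping-pong conditions of
`RAAG.injective_of_pingPong`.
-/

namespace QM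

/-! ### Ping-pong for right-angled Artin groups -/

section PingPong

variable {W : Type u} {Γ : SimpleGraph W}

/-- The element of the right-angled Artin group spelled by a word in syllables `w ^ k`. -/
def syllableProd (Γ : SimpleGraph W) (l : List (W × ℤ)) : RAAG Γ :=
  (l.map fun s => RAAG.of Γ s.1 ^ s.2).prod

@[simp] theorem syllableProd_nil : syllableProd Γ [] = 1 := rfl

@[simp] theorem syllableProd_cons (s : W × ℤ) (l : List (W × ℤ)) :
    syllableProd Γ (s :: l) = RAAG.of Γ s.1 ^ s.2 * syllableProd Γ l := by
  simp [syllableProd]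

theorem exists_syllableProd_eq (g : RAAG Γ) : ∃ l, syllableProd Γ l = g := by
  have hg : g ∈ Subgroup.closure (Set.range (RAAG.of Γ)) := by
    have := PresentedGroup.closure_range_of (raagRelators Γ)
    exact this ▸ Subgroup.mem_top g
  induction hg using Subgroup.closure_induction_left with
  | one => exact ⟨[], rfl⟩
  | mul_left x hx y _ ih =>
    obtain ⟨w, rfl⟩ := hx
    obtain ⟨l, rfl⟩ := ih
    exact ⟨(w, 1) :: l, by simp⟩
  | inv_mul_cancel x hx y _ ih =>
    obtain ⟨w, rfl⟩ := hx
    obtain ⟨l, rfl⟩ := ih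
    exact ⟨(w, -1) :: l, by simp⟩

theorem RAAG.of_mul_of_comm {a b : W} (h : Γ.Adj a b) : Commute (RAAG.of Γ a) (RAAG.of Γ b) := by
  have : PresentedGroup.mk (raagRelators Γ) (FreeGroup.of a * FreeGroup.of b *
      (FreeGroup.of a)⁻¹ * (FreeGroup.of b)⁻¹) = 1 :=
    PresentedGroup.one_of_mem ⟨a, b, h, rfl⟩
  simp only [map_mul, map_inv] at this
  exact (mul_inv_eq_iff_eq_mul.1 (mul_inv_eq_one.1 this) :)

/-- A word in syllables is reduced if no word with fewer syllables spells the same element. -/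
def IsReducedWord (Γ : SimpleGraph W) (l : List (W × ℤ)) : Prop :=
  ∀ l', syllableProd Γ l' = syllableProd Γ l → l.length ≤ l'.length

theorem IsReducedWord.tail {s : W × ℤ} {l : List (W × ℤ)} (h : IsReducedWord Γ (s :: l)) :
    IsReducedWord Γ l := by
  intro l' hl'
  simpa using h (s :: l') (by simp [hl'])

theorem exists_isReducedWord (g : RAAG Γ) :
    ∃ l, IsReducedWord Γ l ∧ syllableProd Γ l = g := by
  have hne : {l | syllableProd Γ l = g}.Nonempty := exists_syllableProd_eq g
  refine ⟨Function.argminOn List.length _ hne, fun l' hl' => ?_, Function.argminOn_mem _ _ hne⟩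
  have hmem : syllableProd Γ (Function.argminOn List.length _ hne) = g :=
    Function.argminOn_mem List.length _ hne
  exact Function.argminOn_le List.length {l | syllableProd Γ l = g} (hl'.trans hmem)

variable {G : Type v} [Group G] {α : Type*} [MulAction G α]

/-- In the ping-pong situation, a reduced word beginning with a power of `w` sends the base point
into the set attached to `w`. If the second syllable commutes with the first one, the two are
swapped and the induction hypothesis is applied to the word without the new first syllable. -/
theorem IsReducedWord.smul_mem (φ : RAAG Γ →* G) (Y : W → Set α) (x₀ : α)
    (h₁ : ∀ w (k : ℤ), k ≠ 0 → φ (RAAG.of Γ w) ^ k • x₀ ∈ Y w)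
    (h₂ : ∀ a b, a ≠ b → ¬ Γ.Adj a b → ∀ k : ℤ, k ≠ 0 → ∀ x ∈ Y b, φ (RAAG.of Γ a) ^ k • x ∈ Y a)
    (h₃ : ∀ a b, Γ.Adj a b → ∀ k : ℤ, ∀ x ∈ Y b, φ (RAAG.of Γ a) ^ k • x ∈ Y b)
    (l : List (W × ℤ)) (w : W) (k : ℤ) (hl : IsReducedWord Γ ((w, k) :: l)) :
    φ (syllableProd Γ ((w, k) :: l)) • x₀ ∈ Y w := by
  induction hn : l.length generalizing l w k with
  | zero =>
    obtain rfl := List.eq_nil_of_length_eq_zero hn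
    have hk : k ≠ 0 := by
      rintro rfl
      simpa using hl [] (by simp)
    simpa using h₁ w k hk
  | succ n ih =>
    obtain ⟨⟨a, m⟩, t, rfl⟩ := List.exists_cons_of_length_eq_add_one hn
    have hk : k ≠ 0 := by
      rintro rfl
      have := hl ((a, m) :: t) (by simp)
      simp at this
    have haw : w ≠ a := by
      rintro rfl
      have := hl ((w, k + m) :: t) (by simp [zpow_add, mul_assoc])
      simp at this
    have ht : t.length = n := by simpa using hn
    by_cases hadj : Γ.Adj w a
    · have hcomm : syllableProd Γ ((w, k) :: (a, m) :: t) =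
          syllableProd Γ ((a, m) :: (w, k) :: t) := by
        simp only [syllableProd_cons, ← mul_assoc]
        rw [((RAAG.of_mul_of_comm hadj).zpow_zpow k m).eq]
      have hred : IsReducedWord Γ ((a, m) :: (w, k) :: t) := by
        intro l' hl'
        simpa using hl l' (hl'.trans hcomm.symm)
      have := ih t w k hred.tail ht
      rw [hcomm, syllableProd_cons, map_mul, map_zpow, mul_smul]
      exact h₃ a w hadj.symm m _ this
    · have := ih t a m hl.tail ht
      rw [syllableProd_cons, map_mul, map_zpow, mul_smul]
      exact h₂ w a haw hadj k hk _ this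

theorem RAAG.injective_of_pingPong (φ : RAAG Γ →* G) (Y : W → Set α) (x₀ : α)
    (h₀ : ∀ w, x₀ ∉ Y w)
    (h₁ : ∀ w (k : ℤ), k ≠ 0 → φ (RAAG.of Γ w) ^ k • x₀ ∈ Y w)
    (h₂ : ∀ a b, a ≠ b → ¬ Γ.Adj a b → ∀ k : ℤ, k ≠ 0 → ∀ x ∈ Y b, φ (RAAG.of Γ a) ^ k • x ∈ Y a)
    (h₃ : ∀ a b, Γ.Adj a b → ∀ k : ℤ, ∀ x ∈ Y b, φ (RAAG.of Γ a) ^ k • x ∈ Y b) :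
    Function.Injective φ := by
  rw [injective_iff_map_eq_one]
  intro g hg
  obtain ⟨l, hl, rfl⟩ := exists_isReducedWord g
  match l, hl with
  | [], _ => rfl
  | (w, k) :: t, hl =>
    have := hl.smul_mem φ Y x₀ h₁ h₂ h₃
    rw [hg, one_smul] at this
    exact absurd this (h₀ w)

end PingPong

/-! ### Hamming distance -/

section Hamming

theorem hammingDist_update_add {ι : Type*} [Fintype ι] [DecidableEq ι] {K : ι → Type*}
    [∀ i, DecidableEq (K i)] (f h : ∀ i, K i) (i : ι)
    (a : K i) :
    hammingDist (Function.update f i a) h + (if f i = h i then 0 else 1) =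
      hammingDist f h + (if a = h i then 0 else 1) := by
  simp only [hammingDist, Finset.card_filter, ne_eq, ite_not]
  rw [← Finset.add_sum_erase _ _ (Finset.mem_univ i),
    ← Finset.add_sum_erase (Finset.univ) (fun j => if f j = h j then 0 else 1) (Finset.mem_univ i)]
  rw [Finset.sum_congr rfl (g := fun j => if f j = h j then 0 else 1)]
  · simp only [Function.update_self]
    ring
  · intro j hj
    rw [Function.update_of_ne (Finset.ne_of_mem_erase hj)]

theorem exists_update_of_hammingDist_eq_one {ι : Type*} [Fintype ι] [DecidableEq ι]
    {K : ι → Type*} [∀ i, DecidableEq (K i)] {f g : ∀ i, K i} (h : hammingDist f g = 1) :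
    ∃ i, f i ≠ g i ∧ g = Function.update f i (g i) := by
  obtain ⟨i, hi⟩ := Finset.card_eq_one.1 h
  have key : ∀ j, f j ≠ g j ↔ j = i := fun j => by
    have := Finset.ext_iff.1 hi j
    simpa using this
  refine ⟨i, (key i).2 rfl, ?_⟩
  funext j
  by_cases hj : j = i
  · subst hj
    simp
  · rw [Function.update_of_ne hj]
    exact (not_not.1 (mt (key j).1 hj)).symm

theorem cartesianProduct_top_adj_iff {ι : Type*} [Fintype ι] [DecidableEq ι] {K : ι → Type u}
    [∀ i, DecidableEq (K i)] {f g : ∀ i, K i} :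
    (cartesianProduct fun i => (⊤ : SimpleGraph (K i))).Adj f g ↔ hammingDist f g = 1 := by
  constructor
  · rintro ⟨i, hi, h⟩
    refine Finset.card_eq_one.2 ⟨i, ?_⟩
    ext j
    by_cases hj : j = i
    · subst hj
      simpa using hi
    · simpa [hj] using h j hj
  · intro h
    obtain ⟨i, hi, hg⟩ := exists_update_of_hammingDist_eq_one h
    refine ⟨i, hi, fun j hj => ?_⟩
    rw [hg, Function.update_of_ne hj]

end Hamming

section Geometry

variable {V : Type u} {X : SimpleGraph V}

/-! ### Convexity of gated hulls -/

theorem exists_adj_dist_eq (hc : X.Connected) {x y : V} {n : ℕ} (h : X.dist x y = n + 1) :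
    ∃ z, X.Adj x z ∧ X.dist z y = n := by
  obtain ⟨p, hp⟩ := hc.exists_walk_length_eq_dist x y
  cases p with
  | nil => simp at h
  | cons hadj q =>
    rename_i z
    refine ⟨z, hadj, ?_⟩
    have h1 := X.dist_le q
    have h2 := hc.dist_triangle (u := x) (v := z) (w := y)
    rw [SimpleGraph.dist_eq_one_iff_adj.2 hadj] at h2
    simp only [SimpleGraph.Walk.length_cons] at hp
    omega

theorem dist_le_add_one_of_adj (hc : X.Connected) {x y : V} (h : X.Adj x y) (z : V) :
    X.dist z x ≤ X.dist z y + 1 := by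
  have := hc.dist_triangle (u := z) (v := y) (w := x)
  rwa [SimpleGraph.dist_eq_one_iff_adj.2 h.symm] at this

theorem dist_eq_two (hc : X.Connected) {x y z : V} (hxz : X.Adj x z) (hzy : X.Adj z y)
    (hne : x ≠ y) (hxy : ¬ X.Adj x y) : X.dist x y = 2 := by
  have h1 := hc.one_lt_dist_of_ne_of_not_adj hne hxy
  have h2 := dist_le_add_one_of_adj hc hzy.symm x
  rw [SimpleGraph.dist_eq_one_iff_adj.2 hxz] at h2
  omega

theorem subset_gatedHull (S : Set V) : S ⊆ gatedHull X S :=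
  Set.subset_sInter fun _ hY => hY.2

theorem gatedHull_convex (hc : X.Connected) (S : Set V) {x y z : V} (hx : x ∈ gatedHull X S)
    (hy : y ∈ gatedHull X S) (h : X.dist x z + X.dist z y = X.dist x y) : z ∈ gatedHull X S := by
  rintro Y ⟨hY, hS⟩
  obtain ⟨t, ht, hg⟩ := hY z
  have h1 := hg x (hx Y ⟨hY, hS⟩)
  have h2 := hg y (hy Y ⟨hY, hS⟩)
  have h3 := hc.dist_triangle (u := x) (v := t) (w := y)
  rw [X.dist_comm (u := z) (v := x), X.dist_comm (u := t) (v := x)] at h1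
  have h0 : X.dist z t = 0 := by omega
  rwa [(hc.dist_eq_zero_iff).1 h0]

theorem mem_gatedHull_of_adj (hc : X.Connected) (S : Set V) {a b d : V} (ha : a ∈ gatedHull X S)
    (hb : b ∈ gatedHull X S) (hab : a ≠ b) (hda : X.Adj d a) (hdb : X.Adj d b) :
    d ∈ gatedHull X S := by
  rintro Y ⟨hY, hS⟩
  obtain ⟨t, ht, hg⟩ := hY d
  have h1 := hg a (ha Y ⟨hY, hS⟩)
  have h2 := hg b (hb Y ⟨hY, hS⟩)
  rw [SimpleGraph.dist_eq_one_iff_adj.2 hda] at h1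
  rw [SimpleGraph.dist_eq_one_iff_adj.2 hdb] at h2
  by_cases h0 : X.dist d t = 0
  · rwa [(hc.dist_eq_zero_iff).1 h0]
  · have ha0 : X.dist t a = 0 := by omega
    have hb0 : X.dist t b = 0 := by omega
    exact absurd (((hc.dist_eq_zero_iff).1 ha0).symm.trans ((hc.dist_eq_zero_iff).1 hb0)) hab

/-! ### Sets with a Hamming metric -/

open scoped Classical in
/-- A set of vertices on which the graph metric is the Hamming metric of a product of finitely many
sets. -/
def IsHammingSet (X : SimpleGraph V) (H : Set V) : Prop :=
  ∃ (n : ℕ) (K : Fin n → Type u) (φ : V → ∀ i, K i), (∀ f, ∃ x ∈ H, φ x = f) ∧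
    ∀ x ∈ H, ∀ y ∈ H, X.dist x y = hammingDist (φ x) (φ y)

/-- The gated hull being convex, distances in the ambient graph are computed by paths in the
hull. -/
theorem isHammingSet_gatedHull (hc : X.Connected) (S : Set V) (hS : S.Nonempty)
    (hprod : IsProductOfCompleteGraphs (X.induce (gatedHull X S))) :
    IsHammingSet X (gatedHull X S) := by
  classical
  obtain ⟨n, K, ⟨e⟩⟩ := hprod
  obtain ⟨s, hs⟩ := hS
  have hs' := subset_gatedHull (X := X) S hs
  let φ : V → ∀ i, K i := fun x => if h : x ∈ gatedHull X S then e ⟨x, h⟩ else e ⟨s, hs'⟩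
  have hφ : ∀ x (h : x ∈ gatedHull X S), φ x = e ⟨x, h⟩ := fun x h => dif_pos h
  have hadj : ∀ x ∈ gatedHull X S, ∀ y ∈ gatedHull X S,
      (X.Adj x y ↔ hammingDist (φ x) (φ y) = 1) := by
    intro x hx y hy
    rw [hφ x hx, hφ y hy, ← cartesianProduct_top_adj_iff, e.map_adj_iff]
    rfl
  have hsurj : ∀ f, ∃ x ∈ gatedHull X S, φ x = f := by
    intro f
    refine ⟨(e.symm f).1, (e.symm f).2, ?_⟩
    rw [hφ _ (e.symm f).2]
    exact e.apply_symm_apply f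
  have hinj : ∀ x ∈ gatedHull X S, ∀ y ∈ gatedHull X S, φ x = φ y → x = y := by
    intro x hx y hy h
    rw [hφ x hx, hφ y hy] at h
    exact congrArg Subtype.val (e.injective h)
  have hle : ∀ m, ∀ x ∈ gatedHull X S, ∀ y ∈ gatedHull X S, X.dist x y = m →
      hammingDist (φ x) (φ y) ≤ m := by
    intro m
    induction m with
    | zero =>
      intro x _ y _ h
      rw [hc.dist_eq_zero_iff] at h
      simp [h]
    | succ m ih =>
      intro x hx y hy h
      obtain ⟨z, hxz, hz⟩ := exists_adj_dist_eq hc h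
      have hzH : z ∈ gatedHull X S := by
        refine gatedHull_convex hc S hx hy ?_
        rw [SimpleGraph.dist_eq_one_iff_adj.2 hxz]
        omega
      have h1 := (hadj x hx z hzH).1 hxz
      have h2 := ih z hzH y hy hz
      have h3 := hammingDist_triangle (φ x) (φ z) (φ y)
      omega
  have hge : ∀ m, ∀ x ∈ gatedHull X S, ∀ y ∈ gatedHull X S, hammingDist (φ x) (φ y) = m →
      X.dist x y ≤ m := by
    intro m
    induction m with
    | zero =>
      intro x hx y hy h
      rw [hammingDist_eq_zero] at h
      simp [hinj x hx y hy h]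
    | succ m ih =>
      intro x hx y hy h
      have hne : φ x ≠ φ y := by
        rw [← hammingDist_ne_zero]
        omega
      obtain ⟨i, hi⟩ := Function.ne_iff.1 hne
      obtain ⟨z, hz, hzφ⟩ := hsurj (Function.update (φ x) i (φ y i))
      have h1 := hammingDist_update_add (φ x) (φ y) i (φ y i)
      have h2 := hammingDist_update_add (φ x) (φ x) i (φ y i)
      rw [if_neg hi, if_pos rfl] at h1
      rw [if_pos rfl, if_neg (Ne.symm hi), hammingDist_self, ← hzφ] at h2
      rw [← hzφ] at h1
      have h3 := ih z hz y hy (by omega)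
      have h4 : X.Adj z x := (hadj z hz x hx).2 (by omega)
      have h5 := dist_le_add_one_of_adj hc h4.symm y
      rw [X.dist_comm (u := y), X.dist_comm (u := y)] at h5
      omega
  exact ⟨n, K, φ, hsurj, fun x hx y hy => le_antisymm (hge _ x hx y hy rfl) (hle _ x hx y hy rfl)⟩

namespace IsHammingSet

variable {H : Set V}

/-- If `v` and `w` differ in one coordinate and are at the same distance from `y`, then giving that
coordinate the value it has at `y` yields a vertex closer to `y`. -/
theorem exists_triangle (h : IsHammingSet X H) {y v w : V} (hy : y ∈ H) (hv : v ∈ H) (hw : w ∈ H)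
    (hvw : X.Adj v w) (hd : X.dist y v = X.dist y w) :
    ∃ z, X.Adj z v ∧ X.Adj z w ∧ X.dist y z + 1 = X.dist y v := by
  classical
  obtain ⟨n, K, φ, hsurj, hφ⟩ := h
  have h1 : hammingDist (φ v) (φ w) = 1 := by
    rw [← hφ v hv w hw]
    exact SimpleGraph.dist_eq_one_iff_adj.2 hvw
  obtain ⟨i, hi, hwi⟩ := exists_update_of_hammingDist_eq_one h1
  rw [X.dist_comm (u := y), X.dist_comm (u := y), hφ v hv y hy, hφ w hw y hy] at hd
  have h2 := hammingDist_update_add (φ v) (φ y) i (φ w i)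
  rw [← hwi, hd] at h2
  have hvy : φ v i ≠ φ y i := by
    intro h
    rw [if_pos h] at h2
    split_ifs at h2 with h'
    · exact hi (h.trans h'.symm)
    · omega
  have hwy : φ w i ≠ φ y i := by
    intro h
    rw [if_neg hvy, if_pos h] at h2
    omega
  obtain ⟨z, hz, hzφ⟩ := hsurj (Function.update (φ v) i (φ y i))
  have hzv := hammingDist_update_add (φ v) (φ v) i (φ y i)
  have hzw := hammingDist_update_add (φ v) (φ w) i (φ y i)
  have hzy := hammingDist_update_add (φ v) (φ y) i (φ y i)
  rw [← hzφ] at hzv hzw hzy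
  rw [if_pos rfl, if_neg hvy.symm, hammingDist_self] at hzv
  rw [if_neg hi, if_neg hwy.symm] at hzw
  rw [if_neg hvy, if_pos rfl] at hzy
  refine ⟨z, ?_, ?_, ?_⟩
  · rw [← SimpleGraph.dist_eq_one_iff_adj, hφ z hz v hv]
    omega
  · rw [← SimpleGraph.dist_eq_one_iff_adj, hφ z hz w hw]
    omega
  · rw [X.dist_comm (u := y), X.dist_comm (u := y), hφ v hv y hy, hφ z hz y hy]
    omega

/-- If `v` and `w` are nonadjacent neighbours of `z` that are closer to `y`, they arise from `z` by
giving two distinct coordinates the values they have at `y`; changing both gives the fourth vertex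
of the square. -/
theorem exists_square (hc : X.Connected) (h : IsHammingSet X H) {y v w z : V}
    (hy : y ∈ H) (hv : v ∈ H) (hw : w ∈ H) (hz : z ∈ H) (hzv : X.Adj z v) (hzw : X.Adj z w)
    (hne : v ≠ w) (hvw : ¬ X.Adj v w)
    (hyv : X.dist y z = X.dist y v + 1) (hyw : X.dist y z = X.dist y w + 1) :
    ∃ t, X.Adj t v ∧ X.Adj t w ∧ X.dist y t + 1 = X.dist y v := by
  classical
  obtain ⟨n, K, φ, hsurj, hφ⟩ := h
  rw [← SimpleGraph.dist_eq_one_iff_adj, hφ _ hz _ hv] at hzv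
  rw [← SimpleGraph.dist_eq_one_iff_adj, hφ _ hz _ hw] at hzw
  rw [← SimpleGraph.dist_eq_one_iff_adj, hφ _ hv _ hw] at hvw
  rw [X.dist_comm (u := y), X.dist_comm (u := y), hφ _ hz _ hy] at hyv hyw
  rw [hφ _ hv _ hy] at hyv
  rw [hφ _ hw _ hy] at hyw
  have hvw0 : hammingDist (φ v) (φ w) ≠ 0 := by
    rw [← hφ _ hv _ hw]
    exact (hc.pos_dist_of_ne hne).ne'
  obtain ⟨i, hi, hvi⟩ := exists_update_of_hammingDist_eq_one hzv
  obtain ⟨j, hj, hwj⟩ := exists_update_of_hammingDist_eq_one hzw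
  have hij : i ≠ j := by
    rintro rfl
    have h1 := hammingDist_update_add (φ z) (φ w) i (φ v i)
    rw [← hvi, if_neg hj] at h1
    split_ifs at h1 <;> omega
  have hvy := hammingDist_update_add (φ z) (φ y) i (φ v i)
  have hwy := hammingDist_update_add (φ z) (φ y) j (φ w j)
  rw [← hvi] at hvy
  rw [← hwj] at hwy
  have hvyi : φ v i = φ y i := by
    by_contra h
    rw [if_neg h] at hvy
    split_ifs at hvy <;> omega
  have hwyj : φ w j = φ y j := by
    by_contra h
    rw [if_neg h] at hwy
    split_ifs at hwy <;> omega
  have hzyj : φ z j ≠ φ y j := fun h => hj (h.trans hwyj.symm)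
  have hvj : φ v j = φ z j := by rw [hvi, Function.update_of_ne hij.symm]
  have hwi : φ w i = φ z i := by rw [hwj, Function.update_of_ne hij]
  obtain ⟨t, ht, htφ⟩ := hsurj (Function.update (φ v) j (φ w j))
  have h1 := hammingDist_update_add (φ v) (φ v) j (φ w j)
  have h2 := hammingDist_update_add (φ v) (φ y) j (φ w j)
  have h3 := hammingDist_update_add (φ v) (φ w) j (φ w j)
  have h4 := hammingDist_update_add (φ z) (φ w) i (φ v i)
  rw [← htφ] at h1 h2 h3
  rw [← hvi, hwi, if_pos rfl, if_neg (Ne.symm hi)] at h4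
  rw [if_pos rfl, hvj, if_neg (Ne.symm hj), hammingDist_self] at h1
  rw [hvj, if_neg hzyj, if_pos hwyj] at h2
  rw [hvj, if_neg hj, if_pos rfl] at h3
  refine ⟨t, ?_, ?_, ?_⟩
  · rw [← SimpleGraph.dist_eq_one_iff_adj, hφ _ ht _ hv]
    omega
  · rw [← SimpleGraph.dist_eq_one_iff_adj, hφ _ ht _ hw]
    omega
  · rw [X.dist_comm (u := y), X.dist_comm (u := y), hφ _ ht _ hy, hφ _ hv _ hy]
    omega

theorem dist_le_one (h : IsHammingSet X H) {a b c d : V} (ha : a ∈ H) (hb : b ∈ H) (hc : c ∈ H)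
    (hd : d ∈ H) (hab : X.Adj a b) (hac : X.Adj a c) (hbc : X.Adj b c) (had : X.Adj a d)
    (hbd : X.Adj b d) : X.dist c d ≤ 1 := by
  classical
  obtain ⟨n, K, φ, hsurj, hφ⟩ := h
  simp only [← SimpleGraph.dist_eq_one_iff_adj] at *
  rw [hφ _ ha _ hb] at hab
  rw [hφ _ ha _ hc] at hac
  rw [hφ _ hb _ hc] at hbc
  rw [hφ _ ha _ hd] at had
  rw [hφ _ hb _ hd] at hbd
  rw [hφ _ hc _ hd]
  obtain ⟨i, hi, hbi⟩ := exists_update_of_hammingDist_eq_one hab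
  have key : ∀ f, hammingDist (φ a) f = 1 → hammingDist (φ b) f = 1 →
      f = Function.update (φ a) i (f i) := by
    intro f haf hbf
    obtain ⟨j, hj, hfj⟩ := exists_update_of_hammingDist_eq_one haf
    have h1 := hammingDist_update_add (φ a) f i (φ b i)
    rw [← hbi, haf, hbf] at h1
    have hij : i = j := by
      by_contra hij
      have h2 : f i = φ a i := by
        rw [hfj, Function.update_of_ne hij]
      rw [h2, if_pos rfl, if_neg (Ne.symm hi)] at h1
      omega
    subst hij
    exact hfj
  have h1 := key _ hac hbc
  have h2 := key _ had hbd
  have h3 := hammingDist_update_add (φ c) (φ c) i (φ d i)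
  have h4 : Function.update (φ c) i (φ d i) = φ d := by
    rw [h1, Function.update_idem]
    exact h2.symm
  rw [h4, hammingDist_self, hammingDist_comm] at h3
  split_ifs at h3 <;> omega

end IsHammingSet

end Geometry

/-! ### Local structure of quasi-median graphs -/

namespace IsQuasiMedian

variable {V : Type u} {X : SimpleGraph V}

/-- A minimal median triangle `a b c` of `u v w`, together with its gated hull `H`. -/
theorem exists_median_hamming (hX : IsQuasiMedian X) (u v w : V) :
    ∃ a b c H, a ∈ H ∧ b ∈ H ∧ c ∈ H ∧ IsHammingSet X H ∧
      (∀ x ∈ H, ∀ y ∈ H, ∀ z, X.dist x z + X.dist z y = X.dist x y → z ∈ H) ∧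
      (∀ x ∈ H, ∀ y ∈ H, ∀ z, x ≠ y → X.Adj z x → X.Adj z y → z ∈ H) ∧
      X.dist u v = X.dist u a + X.dist a b + X.dist b v ∧
      X.dist u w = X.dist u a + X.dist a c + X.dist c w ∧
      X.dist v w = X.dist v b + X.dist b c + X.dist c w := by
  obtain ⟨y, hy, _⟩ := hX.existsUnique_minimal ![u, v, w]
  have hsub := subset_gatedHull (X := X) (Set.range y)
  refine ⟨y 0, y 1, y 2, gatedHull X (Set.range y), hsub ⟨0, rfl⟩, hsub ⟨1, rfl⟩, hsub ⟨2, rfl⟩,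
    isHammingSet_gatedHull hX.connected _ ⟨_, 0, rfl⟩ (hX.hull_product _ _ hy),
    fun x hx x' hx' z h => gatedHull_convex hX.connected _ hx hx' h,
    fun x hx x' hx' z hne h h' => mem_gatedHull_of_adj hX.connected _ hx hx' hne h h',
    hy.1 0 1 (by decide), hy.1 0 2 (by decide), hy.1 1 2 (by decide)⟩

/-- The triangle condition: a median triangle of `u v w` has the edge `vw` as a side, and its gated
hull contains a common neighbour of `v` and `w` closer to `u`. -/
theorem triangle_condition (hX : IsQuasiMedian X) {u v w : V} (hvw : X.Adj v w)
    (h : X.dist u v = X.dist u w) :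
    ∃ z, X.Adj z v ∧ X.Adj z w ∧ X.dist u z + 1 = X.dist u v := by
  obtain ⟨a, b, c, H, ha, hb, hc, hH, -, -, hab, hac, hbc⟩ := hX.exists_median_hamming u v w
  have hcon := hX.connected
  rw [SimpleGraph.dist_eq_one_iff_adj.2 hvw] at hbc
  have h1 := SimpleGraph.dist_eq_one_iff_adj.2 hvw
  have hb0 : X.dist v b = 0 := by
    by_contra h0
    have h2 : X.dist b c = 0 := by omega
    have h3 : X.dist c w = 0 := by omega
    rw [hcon.dist_eq_zero_iff] at h2 h3
    subst h2 h3
    simp only [SimpleGraph.dist_self] at *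
    rw [X.dist_comm (u := v)] at h0
    omega
  have hc0 : X.dist c w = 0 := by
    by_contra h0
    have h2 : X.dist b c = 0 := by omega
    rw [hcon.dist_eq_zero_iff] at h2 hb0
    subst h2 hb0
    simp only [SimpleGraph.dist_self] at *
    omega
  rw [hcon.dist_eq_zero_iff] at hb0 hc0
  subst hb0 hc0
  simp only [SimpleGraph.dist_self] at *
  obtain ⟨z, hzv, hzw, hz⟩ := hH.exists_triangle ha hb hc hvw (by omega)
  refine ⟨z, hzv, hzw, ?_⟩
  have h2 := hcon.dist_triangle (u := u) (v := a) (w := z)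
  have h3 := dist_le_add_one_of_adj hcon hzv.symm u
  omega

/-- The quadrangle condition. A median triangle of `u v w` directly yields a common neighbour of `v`
and `w` closer to `u`, unless `v` and `w` are two of its vertices; then its gated hull contains `z`
and the vertex opposite to `z` in a square. -/
theorem quadrangle_condition (hX : IsQuasiMedian X) {u v w z : V} (hzv : X.Adj z v)
    (hzw : X.Adj z w) (hne : v ≠ w) (hvw : ¬ X.Adj v w) (hv : X.dist u z = X.dist u v + 1)
    (hw : X.dist u z = X.dist u w + 1) :
    ∃ t, X.Adj t v ∧ X.Adj t w ∧ X.dist u t + 1 = X.dist u v := by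
  obtain ⟨a, b, c, H, ha, hb, hc, hH, hconv, -, hab, hac, hbc⟩ := hX.exists_median_hamming u v w
  have hcon := hX.connected
  have h2 : X.dist v w = 2 := dist_eq_two hcon hzv.symm hzw hne hvw
  rw [h2] at hbc
  have t1 := hcon.dist_triangle (u := u) (v := a) (w := b)
  have t2 := hcon.dist_triangle (u := u) (v := a) (w := c)
  have hbv := X.dist_comm (u := b) (v := v)
  have hcases : X.dist b c = 0 ∨ X.dist b c = 1 ∨ X.dist b c = 2 := by omega
  obtain h0 | h0 | h0 := hcases
  · rw [hcon.dist_eq_zero_iff] at h0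
    subst h0
    rw [X.dist_self] at hbc
    have e1 : X.dist v b = 1 := by omega
    have e2 : X.dist b w = 1 := by omega
    exact ⟨b, (SimpleGraph.dist_eq_one_iff_adj.1 e1).symm, SimpleGraph.dist_eq_one_iff_adj.1 e2,
      by have := hcon.dist_triangle (u := u) (v := b) (w := v); omega⟩
  · -- One side of the triangle is an edge, so `v` or `w` is in it and the other end is the vertex.
    have h5 : X.dist v b = 0 ∨ X.dist c w = 0 := by omega
    obtain h5 | h5 := h5
    · have e2 : X.dist c w = 1 := by omega
      rw [hcon.dist_eq_zero_iff] at h5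
      subst h5
      have := hcon.dist_triangle (u := u) (v := c) (w := w)
      exact ⟨c, (SimpleGraph.dist_eq_one_iff_adj.1 h0).symm, SimpleGraph.dist_eq_one_iff_adj.1 e2,
        by omega⟩
    · have e2 : X.dist v b = 1 := by omega
      rw [hcon.dist_eq_zero_iff] at h5
      subst h5
      have := hcon.dist_triangle (u := u) (v := b) (w := v)
      exact ⟨b, (SimpleGraph.dist_eq_one_iff_adj.1 e2).symm, SimpleGraph.dist_eq_one_iff_adj.1 h0,
        by omega⟩
  · have hb0 : X.dist v b = 0 := by omega
    have hc0 : X.dist c w = 0 := by omega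
    rw [hcon.dist_eq_zero_iff] at hb0 hc0
    subst hb0 hc0
    simp only [SimpleGraph.dist_self] at *
    have hz : z ∈ H := hconv v hb c hc z (by
      rw [SimpleGraph.dist_eq_one_iff_adj.2 hzv.symm, SimpleGraph.dist_eq_one_iff_adj.2 hzw, h2])
    have t3 := hcon.dist_triangle (u := u) (v := a) (w := z)
    have t4 := dist_le_add_one_of_adj hcon hzv a
    have t5 := dist_le_add_one_of_adj hcon hzw a
    obtain ⟨t, htv, htw, ht⟩ := hH.exists_square hcon ha hb hc hz hzv hzw hne hvw
      (by omega) (by omega)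
    refine ⟨t, htv, htw, ?_⟩
    have t6 := hcon.dist_triangle (u := u) (v := a) (w := t)
    have t7 := dist_le_add_one_of_adj hcon htv.symm u
    omega

/-- A quasi-median graph contains no induced `K₄` minus an edge. -/
theorem adj_of_common_adj (hX : IsQuasiMedian X) {a b c d : V} (hab : X.Adj a b)
    (hac : X.Adj a c) (hbc : X.Adj b c) (had : X.Adj a d) (hbd : X.Adj b d) (hcd : c ≠ d) :
    X.Adj c d := by
  obtain ⟨x, y, z, H, hx, hy, hz, hH, -, hadj, h1, h2, h3⟩ := hX.exists_median_hamming a b c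
  have hcon := hX.connected
  rw [SimpleGraph.dist_eq_one_iff_adj.2 hab] at h1
  rw [SimpleGraph.dist_eq_one_iff_adj.2 hac] at h2
  rw [SimpleGraph.dist_eq_one_iff_adj.2 hbc] at h3
  have hbne := hbc.ne
  have hane := hab.ne
  have hcne := hac.ne
  -- A median triangle of a triangle is the triangle itself.
  have key : X.dist a x = 0 ∧ X.dist b y = 0 ∧ X.dist z c = 0 := by
    have hyb := X.dist_comm (u := y) (v := b)
    have e1 : X.dist a x = 0 := by
      by_contra h0
      have e2 : X.dist y b = 0 := by omega
      have e3 : X.dist z c = 0 := by omega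
      have e4 : X.dist x y = 0 := by omega
      have e5 : X.dist x z = 0 := by omega
      rw [hcon.dist_eq_zero_iff] at e2 e3 e4 e5
      exact hbne (e2.symm.trans (e4.symm.trans (e5.trans e3)))
    have e2 : X.dist b y = 0 := by
      by_contra h0
      have e3 : X.dist z c = 0 := by omega
      have e4 : X.dist x y = 0 := by omega
      have e5 : X.dist y z = 0 := by omega
      rw [hcon.dist_eq_zero_iff] at e1 e3 e4 e5
      exact hcne (e1.trans (e4.trans (e5.trans e3)))
    refine ⟨e1, e2, ?_⟩
    by_contra h0
    have e4 : X.dist y z = 0 := by omega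
    have e5 : X.dist x z = 0 := by omega
    rw [hcon.dist_eq_zero_iff] at e1 e2 e4 e5
    exact hane (e1.trans (e5.trans (e4.symm.trans e2.symm)))
  simp only [hcon.dist_eq_zero_iff] at key
  obtain ⟨rfl, rfl, rfl⟩ := key
  have hd := hadj a hx b hy d hane had.symm hbd.symm
  have hle := hH.dist_le_one hx hy hz hd hab hac hbc had hbd
  have hpos := hcon.pos_dist_of_ne hcd
  exact SimpleGraph.dist_eq_one_iff_adj.1 (by omega)

/-- A quasi-median graph contains no `K_{2,3}`, as the two vertices of its smaller side would both
be medians of the other three. -/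
theorem eq_of_common_adj (hX : IsQuasiMedian X) {u v a b c : V} (huv : ¬ X.Adj u v) (hne : u ≠ v)
    (hua : X.Adj u a) (hva : X.Adj v a) (hub : X.Adj u b) (hvb : X.Adj v b)
    (huc : X.Adj u c) (hvc : X.Adj v c) (hab : a ≠ b) (hac : a ≠ c) : b = c := by
  by_contra hbc
  have hcon := hX.connected
  let x : Fin 3 → V := ![a, b, c]
  have hxu : ∀ i, X.dist (x i) u = 1 := by
    intro i
    rw [SimpleGraph.dist_eq_one_iff_adj]
    fin_cases i
    exacts [hua.symm, hub.symm, huc.symm]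
  have hxv : ∀ i, X.dist (x i) v = 1 := by
    intro i
    rw [SimpleGraph.dist_eq_one_iff_adj]
    fin_cases i
    exacts [hva.symm, hvb.symm, hvc.symm]
  have hinj : ∀ i j, i ≠ j → x i ≠ x j := by
    intro i j hij
    fin_cases i <;> fin_cases j <;> simp_all [x, eq_comm]
  have hd : ∀ i j, i ≠ j → X.dist (x i) (x j) = 2 := by
    intro i j hij
    have adj : ∀ i, X.Adj (x i) u ∧ X.Adj (x i) v := fun i =>
      ⟨SimpleGraph.dist_eq_one_iff_adj.1 (hxu i), SimpleGraph.dist_eq_one_iff_adj.1 (hxv i)⟩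
    refine dist_eq_two hcon (adj i).1 (adj j).1.symm (hinj i j hij) fun hadj => huv ?_
    exact hX.adj_of_common_adj hadj (adj i).1 (adj j).1 (adj i).2 (adj j).2 hne
  have hmed : ∀ m, (∀ i, X.dist (x i) m = 1) → IsMinimalMedianTriangle X x fun _ => m := by
    intro m hm
    refine ⟨fun i j hij => ?_, fun y' _ => by simp [triangleSize]⟩
    rw [hd i j hij, hm, X.dist_comm, X.dist_self, X.dist_comm, hm]
  have := (hX.existsUnique_minimal x).unique (hmed u hxu) (hmed v hxv)
  exact hne (congrFun this 0)

/-! ### Distances on squares -/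

/-- Two opposite, nonadjacent corners of a `4`-cycle have no common neighbours besides the other two
corners. -/
theorem not_adj_of_square (hX : IsQuasiMedian X) {a b c d s : V} (hab : X.Adj a b)
    (hbc : X.Adj b c) (hcd : X.Adj c d) (hda : X.Adj d a) (hac : a ≠ c)
    (hbd : ¬ X.Adj b d) (hbd' : b ≠ d) (hsa : s ≠ a) (hsc : s ≠ c) (hsb : X.Adj s b) :
    ¬ X.Adj s d := fun hsd =>
  hsc (hX.eq_of_common_adj hbd hbd' hab.symm hda hbc hcd.symm hsb.symm hsd.symm hac hsa.symm).symm

/-- On an induced square, the distances to a vertex do not follow the pattern `k, k, k, k + 1`: the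
quadrangle condition would give the opposite corners `a` and `c` a third common neighbour. -/
theorem dist_square_ne_of_far_corner (hX : IsQuasiMedian X) {a b c d : V} (u : V) (hab : X.Adj a b)
    (hbc : X.Adj b c) (hcd : X.Adj c d) (hda : X.Adj d a) (hac : ¬ X.Adj a c) (hac' : a ≠ c)
    (hbd : ¬ X.Adj b d) (hbd' : b ≠ d) :
    ¬ (X.dist u b = X.dist u a ∧ X.dist u c = X.dist u a ∧ X.dist u d = X.dist u a + 1) := by
  rintro ⟨h1, h2, h3⟩
  obtain ⟨w, hwa, hwc, hw⟩ := hX.quadrangle_condition (u := u) hda hcd.symm hac' hac h3 (by omega)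
  have hwb : w ≠ b := by
    rintro rfl
    omega
  have hwd : w ≠ d := by
    rintro rfl
    omega
  exact hX.not_adj_of_square hbc hcd hda hab hbd' (fun h => hac h.symm) hac'.symm hwb hwd hwc hwa

/-- On an induced square, the distances to a vertex do not follow the pattern
`k, k + 1, k, k + 1`. -/
theorem dist_square_ne_alternating (hX : IsQuasiMedian X) {a b c d : V} (u : V) (hab : X.Adj a b)
    (hbc : X.Adj b c) (hcd : X.Adj c d) (hda : X.Adj d a) (hac : ¬ X.Adj a c) (hac' : a ≠ c)
    (hbd : ¬ X.Adj b d) (hbd' : b ≠ d) :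
    ¬ (X.dist u c = X.dist u a ∧ X.dist u b = X.dist u a + 1 ∧ X.dist u d = X.dist u a + 1) := by
  rintro ⟨h1, h2, h3⟩
  obtain ⟨w, hwa, hwc, hw⟩ := hX.quadrangle_condition (u := u) hda hcd.symm hac' hac h3 (by omega)
  have hwb : w ≠ b := by
    rintro rfl
    omega
  have hwd : w ≠ d := by
    rintro rfl
    omega
  exact hX.not_adj_of_square hbc hcd hda hab hbd' (fun h => hac h.symm) hac'.symm hwb hwd hwc hwa

/-- On an induced square, the distances to a vertex do not follow the pattern
`k, k + 1, k + 1, k + 1`. The triangle condition gives a common neighbour `t` of `b` and `c` closer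
to `u`, and then a common neighbour `s` of `a` and `d` adjacent to `t`; the distances from `u` to
the induced square `a b t s` follow one of the two patterns already excluded. -/
theorem dist_square_ne_of_near_corner (hX : IsQuasiMedian X) {a b c d : V} (u : V) (hab : X.Adj a b)
    (hbc : X.Adj b c) (hcd : X.Adj c d) (hda : X.Adj d a) (hac : ¬ X.Adj a c) (hac' : a ≠ c)
    (hbd : ¬ X.Adj b d) (hbd' : b ≠ d) :
    ¬ (X.dist u b = X.dist u a + 1 ∧ X.dist u c = X.dist u a + 1 ∧
      X.dist u d = X.dist u a + 1) := by
  rintro ⟨h1, h2, h3⟩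
  have hcon := hX.connected
  obtain ⟨t, htb, htc, ht⟩ := hX.triangle_condition (u := u) hbc (by omega)
  have hta' : t ≠ a := by
    rintro rfl
    exact hac htc
  have htd' : t ≠ d := by
    rintro rfl
    omega
  have htc' := htc.ne
  have hta : ¬ X.Adj t a :=
    hX.not_adj_of_square hbc hcd hda hab hbd' (fun h => hac h.symm) hac'.symm htb.ne htd' htc
  have htd : ¬ X.Adj t d := hX.not_adj_of_square hab hbc hcd hda hac' hbd hbd' hta' htc' htb
  have e1 : X.dist t a = 2 := dist_eq_two hcon htb hab.symm hta' hta
  have e2 : X.dist t d = 2 := dist_eq_two hcon htc hcd htd' htd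
  obtain ⟨s, hsd, hsa, hs⟩ := hX.triangle_condition (u := t) hda (e2.trans e1.symm)
  have hst : X.Adj t s := SimpleGraph.dist_eq_one_iff_adj.1 (by omega)
  have hsb' : s ≠ b := by
    rintro rfl
    exact hbd hsd
  have hsc' : s ≠ c := by
    rintro rfl
    exact hac hsa.symm
  have hbs : ¬ X.Adj b s := fun h =>
    hX.not_adj_of_square hab hbc hcd hda hac' hbd hbd' hsa.ne hsc' h.symm hsd
  have e3 := dist_le_add_one_of_adj hcon hsd.symm u
  have e4 := dist_le_add_one_of_adj hcon hsa u
  have ha_t : ¬ X.Adj a t := fun h => hta h.symm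
  have : X.dist u s = X.dist u a ∨ X.dist u s = X.dist u a + 1 := by omega
  obtain h | h := this
  · refine hX.dist_square_ne_of_far_corner u hsa.symm hst.symm htb hab.symm ha_t hta'.symm
      (fun h => hbs h.symm) hsb' ⟨h, by omega, by omega⟩
  · exact hX.dist_square_ne_alternating u hab htb.symm hst hsa ha_t hta'.symm hbs hsb'.symm
      ⟨by omega, by omega, by omega⟩

/-- On an induced square, the distance to a vertex is a sum of functions of the two directions of
the square. -/
theorem dist_square (hX : IsQuasiMedian X) {a b c d : V} (u : V) (hab : X.Adj a b)
    (hbc : X.Adj b c) (hcd : X.Adj c d) (hda : X.Adj d a) (hac : ¬ X.Adj a c) (hac' : a ≠ c)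
    (hbd : ¬ X.Adj b d) (hbd' : b ≠ d) :
    X.dist u a + X.dist u c = X.dist u b + X.dist u d := by
  have hcon := hX.connected
  have hca : ¬ X.Adj c a := fun h => hac h.symm
  have hdb : ¬ X.Adj d b := fun h => hbd h.symm
  have p1 := hX.dist_square_ne_of_far_corner u hab hbc hcd hda hac hac' hbd hbd'
  have p2 := hX.dist_square_ne_of_far_corner u hbc hcd hda hab hbd hbd' hca hac'.symm
  have p3 := hX.dist_square_ne_of_far_corner u hcd hda hab hbc hca hac'.symm hdb hbd'.symm
  have p4 := hX.dist_square_ne_of_far_corner u hda hab hbc hcd hdb hbd'.symm hac hac'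
  have q1 := hX.dist_square_ne_alternating u hab hbc hcd hda hac hac' hbd hbd'
  have q2 := hX.dist_square_ne_alternating u hbc hcd hda hab hbd hbd' hca hac'.symm
  have r1 := hX.dist_square_ne_of_near_corner u hab hbc hcd hda hac hac' hbd hbd'
  have r2 := hX.dist_square_ne_of_near_corner u hbc hcd hda hab hbd hbd' hca hac'.symm
  have r3 := hX.dist_square_ne_of_near_corner u hcd hda hab hbc hca hac'.symm hdb hbd'.symm
  have r4 := hX.dist_square_ne_of_near_corner u hda hab hbc hcd hdb hbd'.symm hac hac'
  have key : ∀ {x y : V}, X.Adj x y →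
      X.dist u y = X.dist u x ∨ X.dist u y = X.dist u x + 1 ∨ X.dist u x = X.dist u y + 1 := by
    intro x y h
    have h1 := dist_le_add_one_of_adj hcon h u
    have h2 := dist_le_add_one_of_adj hcon h.symm u
    omega
  have k1 := key hab
  have k2 := key hbc
  have k3 := key hcd
  have k4 := key hda
  clear key
  generalize X.dist u a = α at *
  generalize X.dist u b = β at *
  generalize X.dist u c = γ at *
  generalize X.dist u d = δ at *
  rcases k1 with k1 | k1 | k1 <;> rcases k2 with k2 | k2 | k2 <;>
    rcases k3 with k3 | k3 | k3 <;> grind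

end IsQuasiMedian

/-! ### Gates in cliques -/

section Cliques

variable {V : Type u} {X : SimpleGraph V}

/-- `g` is the gate of `x` in the clique `C`: the vertex of `C` closest to `x`, all others being
one step farther. -/
def IsCliqueGate (X : SimpleGraph V) (C : Set V) (x g : V) : Prop :=
  g ∈ C ∧ ∀ c ∈ C, c ≠ g → X.dist x c = X.dist x g + 1

theorem IsQuasiMedian.exists_isCliqueGate (hX : IsQuasiMedian X) {C : Set V}
    (hC : Maximal X.IsClique C) (hne : C.Nonempty) (x : V) : ∃ g, IsCliqueGate X C x g := by
  have hcon := hX.connected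
  let g := Function.argminOn (X.dist x) C hne
  have hg : g ∈ C := Function.argminOn_mem _ _ hne
  have hmin : ∀ c ∈ C, X.dist x g ≤ X.dist x c := fun c hc =>
    Function.argminOn_le (X.dist x) C hc
  refine ⟨g, hg, fun c hc hcg => ?_⟩
  have hadj : X.Adj g c := hC.prop hg hc hcg.symm
  have h1 := hmin c hc
  have h2 := dist_le_add_one_of_adj hcon hadj.symm x
  by_contra h
  obtain ⟨z, hzg, hzc, hz⟩ := hX.triangle_condition (u := x) hadj (by omega)
  -- `z` is adjacent to two vertices of `C`, hence to all of them.
  have hzC : z ∈ C := by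
    refine hC.mem_of_prop_insert (SimpleGraph.isClique_insert.2 ⟨hC.prop, fun e he hze => ?_⟩)
    by_cases heg : e = g
    · exact heg ▸ hzg
    by_cases hec : e = c
    · exact hec ▸ hzc
    exact hX.adj_of_common_adj hadj hzg.symm hzc.symm (hC.prop hg he (Ne.symm heg))
      (hC.prop hc he (Ne.symm hec)) hze
  have := hmin z hzC
  omega

/-- In a triangle, if two vertices have the same gate, then so does the third. -/
theorem IsQuasiMedian.isCliqueGate_of_triangle (hX : IsQuasiMedian X) {C : Set V}
    (hC : Maximal X.IsClique C) {a b c g : V} (hab : X.Adj a b) (hbc : X.Adj b c)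
    (hca : X.Adj c a) (ha : IsCliqueGate X C a g) (hc : IsCliqueGate X C c g) :
    IsCliqueGate X C b g := by
  have hcon := hX.connected
  obtain ⟨β, hβ⟩ := hX.exists_isCliqueGate hC ⟨g, ha.1⟩ b
  by_cases h : β = g
  · exact h ▸ hβ
  exfalso
  have h1 := ha.2 β hβ.1 h
  have h2 := hc.2 β hβ.1 h
  have h3 := hβ.2 g ha.1 (Ne.symm h)
  have h4 := dist_le_add_one_of_adj hcon hab β
  have h5 := dist_le_add_one_of_adj hcon hbc.symm β
  have h6 := dist_le_add_one_of_adj hcon hab.symm g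
  have h7 := dist_le_add_one_of_adj hcon hbc g
  simp only [X.dist_comm (u := β), X.dist_comm (u := g)] at h4 h5 h6 h7
  obtain ⟨z, hza, hzc, hz⟩ := hX.triangle_condition (u := g) hca.symm (by
    rw [X.dist_comm, X.dist_comm (u := g)]
    omega)
  simp only [X.dist_comm (u := g)] at hz
  have hzb : z ≠ b := by
    rintro rfl
    omega
  have hadj := hX.adj_of_common_adj hca.symm hza.symm hzc.symm hab hbc.symm hzb
  have h8 := dist_le_add_one_of_adj hcon hadj.symm g
  simp only [X.dist_comm (u := g)] at h8
  omega

/-- If two consecutive vertices of a square have the same gate, then the two others have a common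
gate. -/
theorem IsQuasiMedian.exists_isCliqueGate_of_square (hX : IsQuasiMedian X) {C : Set V}
    (hC : Maximal X.IsClique C) {a b c d g : V} (h : IsFourCycle X a b c d)
    (hc : IsCliqueGate X C c g) (hd : IsCliqueGate X C d g) :
    ∃ g', IsCliqueGate X C a g' ∧ IsCliqueGate X C b g' := by
  obtain ⟨hab, hbc, hcd, hda, hac, hbd⟩ := h
  by_cases hac' : X.Adj a c
  · have ha := hX.isCliqueGate_of_triangle hC hac'.symm hda.symm hcd.symm hc hd
    exact ⟨g, ha, hX.isCliqueGate_of_triangle hC hab hbc hac'.symm ha hc⟩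
  by_cases hbd' : X.Adj b d
  · have hb := hX.isCliqueGate_of_triangle hC hbc.symm hbd' hcd.symm hc hd
    exact ⟨g, hX.isCliqueGate_of_triangle hC hab.symm hda.symm hbd'.symm hb hd, hb⟩
  obtain ⟨α, hα⟩ := hX.exists_isCliqueGate hC ⟨g, hc.1⟩ a
  obtain ⟨β, hβ⟩ := hX.exists_isCliqueGate hC ⟨g, hc.1⟩ b
  by_cases hαβ : α = β
  · subst hαβ
    exact ⟨α, hα, hβ⟩
  exfalso
  have h1 := hX.dist_square α hab hbc hcd hda hac' hac hbd' hbd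
  have h2 := hX.dist_square β hab hbc hcd hda hac' hac hbd' hbd
  simp only [X.dist_comm (u := α), X.dist_comm (u := β)] at h1 h2
  have h3 := hα.2 β hβ.1 (Ne.symm hαβ)
  have h4 := hβ.2 α hα.1 hαβ
  by_cases hαg : α = g
  · have hβg : β ≠ g := fun h => hαβ (hαg.trans h.symm)
    have h5 := hc.2 β hβ.1 hβg
    have h6 := hd.2 β hβ.1 hβg
    subst hαg
    omega
  · have h7 := hc.2 α hα.1 hαg
    have h8 := hd.2 α hα.1 hαg
    by_cases hβg : β = g
    · subst hβg
      omega
    · have h5 := hc.2 β hβ.1 hβg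
      have h6 := hd.2 β hβ.1 hβg
      omega

end Cliques

/-! ### Hyperplanes and sectors -/

section Hyperplanes

variable {V : Type u} {X : SimpleGraph V}

theorem ElemParallel.mem_edgeSet {e f : Sym2 V} (h : ElemParallel X e f) :
    e ∈ X.edgeSet ∧ f ∈ X.edgeSet := by
  cases h with
  | triangle a b c hab hbc hca => exact ⟨hab, hca.symm⟩
  | square a b c d h => exact ⟨h.1, h.2.2.1⟩

namespace Hyperplane

variable {J K : Hyperplane X}

theorem adj {a b : V} (h : s(a, b) ∈ J.1) : X.Adj a b := by
  obtain ⟨J, e, he, rfl⟩ := J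
  exact h.1

theorem exists_edge (J : Hyperplane X) : ∃ a b, s(a, b) ∈ J.1 := by
  obtain ⟨J, e, he, rfl⟩ := J
  induction e with
  | _ a b => exact ⟨a, b, he, .refl _⟩

theorem mem_iff_of_elemParallel {e f : Sym2 V} (h : ElemParallel X e f) :
    e ∈ J.1 ↔ f ∈ J.1 := by
  obtain ⟨J, e₀, he, rfl⟩ := J
  exact ⟨fun h' => ⟨h.mem_edgeSet.2, h'.2.trans _ _ _ (.rel _ _ h)⟩,
    fun h' => ⟨h.mem_edgeSet.1, h'.2.trans _ _ _ (.symm _ _ (.rel _ _ h))⟩⟩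

/-- A property of edges that is invariant under elementary parallelism holds on a whole hyperplane
as soon as it holds for one of its edges. -/
theorem forall_of_elemParallel {P : Sym2 V → Prop}
    (hP : ∀ e f, ElemParallel X e f → (P e ↔ P f)) {e₀ : Sym2 V} (h₀ : e₀ ∈ J.1) (hP₀ : P e₀)
    {e : Sym2 V} (he : e ∈ J.1) : P e := by
  have key : ∀ e f, Relation.EqvGen (ElemParallel X) e f → (P e ↔ P f) := by
    intro e f h
    induction h with
    | rel _ _ h => exact hP _ _ h
    | refl => exact Iff.rfl
    | symm _ _ _ ih => exact ih.symm
    | trans _ _ _ _ _ ih ih' => exact ih.trans ih'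
  obtain ⟨J, e₁, he₁, rfl⟩ := J
  exact ((key _ _ h₀.2).symm.trans (key _ _ he.2)).1 hP₀

theorem eq_of_mem {e : Sym2 V} (hJ : e ∈ J.1) (hK : e ∈ K.1) : J = K := by
  refine Subtype.ext (Set.Subset.antisymm (fun f hf => ?_) fun f hf => ?_)
  · exact forall_of_elemParallel (P := (· ∈ K.1)) (fun _ _ => mem_iff_of_elemParallel) hJ hK hf
  · exact forall_of_elemParallel (P := (· ∈ J.1)) (fun _ _ => mem_iff_of_elemParallel) hK hJ hf

theorem mem_of_triangle {a b c : V} (h : s(a, b) ∈ J.1) (hac : X.Adj a c) (hbc : X.Adj b c) :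
    s(a, c) ∈ J.1 :=
  (mem_iff_of_elemParallel (.triangle a b c (adj h) hbc hac.symm)).1 h

theorem mem_of_triangle' {a b c : V} (h : s(a, b) ∈ J.1) (hac : X.Adj a c) (hbc : X.Adj b c) :
    s(b, c) ∈ J.1 :=
  mem_of_triangle (Sym2.eq_swap ▸ h) hbc hac

theorem mem_of_square {a b c d : V} (h : IsFourCycle X a b c d) (hab : s(a, b) ∈ J.1) :
    s(c, d) ∈ J.1 :=
  (mem_iff_of_elemParallel (.square a b c d h)).1 hab

theorem exists_clique {a b : V} (h : s(a, b) ∈ J.1) : ∃ C ∈ cliquesIn J, a ∈ C ∧ b ∈ C := by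
  have hadj := adj h
  have hpair : X.IsClique {a, b} := SimpleGraph.isClique_pair.2 fun _ => hadj
  obtain ⟨C, hsub, hC⟩ := zorn_subset_nonempty {C | X.IsClique C} (by
    intro c hc hchain _
    refine ⟨⋃₀ c, ?_, fun s hs => Set.subset_sUnion_of_mem hs⟩
    rintro x ⟨s, hs, hxs⟩ y ⟨t, ht, hyt⟩ hxy
    obtain hst | hst := hchain.total hs ht
    · exact hc ht (hst hxs) hyt hxy
    · exact hc hs hxs (hst hyt) hxy) _ hpair
  have ha : a ∈ C := hsub (by simp)
  have hb : b ∈ C := hsub (by simp)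
  have hmax : Maximal X.IsClique C := hC
  have hax : ∀ x ∈ C, a ≠ x → s(a, x) ∈ J.1 := by
    intro x hx hax
    by_cases hbx : b = x
    · exact hbx ▸ h
    · exact mem_of_triangle h (hmax.prop ha hx hax) (hmax.prop hb hx hbx)
  refine ⟨C, ⟨hmax, ⟨a, ha, b, hb, hadj.ne⟩, fun x hx y hy hxy => ?_⟩, ha, hb⟩
  by_cases hx' : a = x
  · exact hx' ▸ hax y hy (by rwa [hx'])
  by_cases hy' : a = y
  · rw [Sym2.eq_swap]
    exact hy' ▸ hax x hx hx'
  exact mem_of_triangle' (hax x hx hx') (hmax.prop ha hy hy') (hmax.prop hx hy hxy)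

/-- The ends of an edge of `J` have distinct gates in a clique of `J`. -/
theorem not_isCliqueGate (hX : IsQuasiMedian X) {C : Set V} (hC : C ∈ cliquesIn J) {x y g : V}
    (h : s(x, y) ∈ J.1) (hx : IsCliqueGate X C x g) : ¬ IsCliqueGate X C y g := by
  obtain ⟨hmax, ⟨p, hp, q, hq, hpq⟩, hCJ⟩ := hC
  let P : Sym2 V → Prop := fun e => ¬ ∃ g, ∀ x ∈ e, IsCliqueGate X C x g
  have hP : ∀ e f, ElemParallel X e f → (P e ↔ P f) := by
    intro e f hef
    refine not_congr ?_
    cases hef with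
    | triangle a b c hab hbc hca =>
      simp only [Sym2.forall_mem_pair]
      constructor
      · rintro ⟨g, ha, hb⟩
        exact ⟨g, ha, hX.isCliqueGate_of_triangle hmax hca.symm hbc.symm hab.symm ha hb⟩
      · rintro ⟨g, ha, hc⟩
        exact ⟨g, ha, hX.isCliqueGate_of_triangle hmax hab hbc hca ha hc⟩
    | square a b c d h =>
      simp only [Sym2.forall_mem_pair]
      obtain ⟨hab, hbc, hcd, hda, hac, hbd⟩ := h
      constructor
      · rintro ⟨g, ha, hb⟩
        exact hX.exists_isCliqueGate_of_square hmax ⟨hcd, hda, hab, hbc, hac.symm, hbd.symm⟩ ha hb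
      · rintro ⟨g, hc, hd⟩
        exact hX.exists_isCliqueGate_of_square hmax ⟨hab, hbc, hcd, hda, hac, hbd⟩ hc hd
  have hself : ∀ z ∈ C, ∀ g, IsCliqueGate X C z g → z = g := by
    intro z hz g hg
    by_contra hne
    have := hg.2 z hz hne
    rw [X.dist_self] at this
    omega
  have hpqP : P s(p, q) := by
    rintro ⟨g, hg⟩
    rw [Sym2.forall_mem_pair] at hg
    exact hpq ((hself p hp g hg.1).trans (hself q hq g hg.2).symm)
  have hxyP : P s(x, y) := forall_of_elemParallel hP (hCJ p hp q hq hpq) hpqP h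
  exact fun hy => hxyP ⟨g, Sym2.forall_mem_pair.2 ⟨hx, hy⟩⟩

/-- `x` and `y` lie in the same sector delimited by `J`. -/
def SameSector (J : Hyperplane X) (x y : V) : Prop := (X.deleteEdges J.1).Reachable x y

namespace SameSector

theorem symm {x y : V} (h : J.SameSector x y) : J.SameSector y x :=
  SimpleGraph.Reachable.symm h

theorem trans {x y z : V} (h : J.SameSector x y) (h' : J.SameSector y z) : J.SameSector x z :=
  SimpleGraph.Reachable.trans h h'

theorem refl (J : Hyperplane X) (x : V) : J.SameSector x x :=
  SimpleGraph.Reachable.refl x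

theorem of_adj {x y : V} (h : X.Adj x y) (h' : s(x, y) ∉ J.1) : J.SameSector x y :=
  SimpleGraph.Adj.reachable (SimpleGraph.deleteEdges_adj.2 ⟨h, h'⟩)

end SameSector

/-- Every sector delimited by `J` meets every clique of `J`: a geodesic from a vertex to its gate
has no edge in `J`, since its vertices all have the same gate. -/
theorem exists_sameSector_mem_clique (hX : IsQuasiMedian X) {C : Set V} (hC : C ∈ cliquesIn J)
    (x : V) : ∃ g ∈ C, J.SameSector x g := by
  have hcon := hX.connected
  obtain ⟨g, hg⟩ := hX.exists_isCliqueGate hC.1 hC.2.1.nonempty x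
  refine ⟨g, hg.1, ?_⟩
  induction hn : X.dist x g generalizing x with
  | zero =>
    rw [hcon.dist_eq_zero_iff] at hn
    exact hn ▸ .refl J x
  | succ n ih =>
    obtain ⟨z, hxz, hz⟩ := exists_adj_dist_eq hcon hn
    have hzg : IsCliqueGate X C z g := by
      refine ⟨hg.1, fun c hc hcg => ?_⟩
      have h1 := hg.2 c hc hcg
      have h2 := dist_le_add_one_of_adj hcon hxz c
      have h3 := dist_le_add_one_of_adj hcon (hC.1.prop hc hg.1 hcg) z
      simp only [X.dist_comm (u := c)] at h2
      omega
    exact (SameSector.of_adj hxz fun h => not_isCliqueGate hX hC h hg hzg).trans (ih z hzg hz)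

/-- The carrier of a hyperplane: the set of ends of its edges. -/
def carrier (J : Hyperplane X) : Set V := {x | ∃ y, s(x, y) ∈ J.1}

theorem carrier_nonempty (J : Hyperplane X) : J.carrier.Nonempty := by
  obtain ⟨a, b, h⟩ := J.exists_edge
  exact ⟨a, b, h⟩

/-- A hyperplane lies in a single sector of every hyperplane it is not transverse to. -/
theorem sameSector_of_mem_of_not_transverse (hJK : J ≠ K) (htr : ¬ Transverse J K) {x y : V}
    (hx : x ∈ K.carrier) (hy : y ∈ K.carrier) : J.SameSector x y := by
  obtain ⟨x', hx⟩ := hx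
  obtain ⟨y', hy⟩ := hy
  -- Along a triangle or a square of `K`, the side joining two edges of `K` is not in `J`.
  let P : Sym2 V → Prop := fun e => e ∈ K.1 ∧ ∀ z ∈ e, J.SameSector x z
  have hself : ∀ {a b}, s(a, b) ∈ K.1 → J.SameSector a b := fun h =>
    .of_adj (adj h) fun h' => hJK (eq_of_mem h' h)
  have himp : ∀ {a b c}, s(a, b) ∈ K.1 → J.SameSector x c → J.SameSector c a →
      ∀ z ∈ s(a, b), J.SameSector x z := fun h h' h'' =>
    Sym2.forall_mem_pair.2 ⟨h'.trans h'', (h'.trans h'').trans (hself h)⟩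
  have hside : ∀ {a b c d}, IsFourCycle X a b c d → s(a, b) ∈ K.1 → J.SameSector b c := by
    intro a b c d h hab
    refine .of_adj h.2.1 fun hbc => htr ⟨b, c, d, a, ?_, hbc, ?_, ?_, hab⟩
    · exact ⟨h.2.1, h.2.2.1, h.2.2.2.1, h.1, h.2.2.2.2.2, h.2.2.2.2.1.symm⟩
    · exact mem_of_square ⟨h.2.1, h.2.2.1, h.2.2.2.1, h.1, h.2.2.2.2.2, h.2.2.2.2.1.symm⟩ hbc
    · exact mem_of_square h hab
  have hP : ∀ e f, ElemParallel X e f → (P e ↔ P f) := by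
    intro e f hef
    cases hef with
    | triangle a b c hab hbc hca =>
      have hiff := mem_iff_of_elemParallel (J := K) (.triangle a b c hab hbc hca)
      constructor
      · rintro ⟨he, h⟩
        exact ⟨hiff.1 he, himp (hiff.1 he) (h a (by simp)) (.refl J a)⟩
      · rintro ⟨he, h⟩
        exact ⟨hiff.2 he, himp (hiff.2 he) (h a (by simp)) (.refl J a)⟩
    | square a b c d hsq =>
      have hiff := mem_iff_of_elemParallel (J := K) (.square a b c d hsq)
      constructor
      · rintro ⟨he, h⟩
        exact ⟨hiff.1 he, himp (hiff.1 he) (h b (by simp)) (hside hsq he)⟩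
      · rintro ⟨he, h⟩
        exact ⟨hiff.2 he, himp (hiff.2 he) ((h c (by simp)).trans (hside hsq (hiff.2 he)).symm)
          (hself (hiff.2 he)).symm⟩
  have hx₀ : P s(x, x') := ⟨hx, himp hx (.refl J x) (.refl J x)⟩
  exact (forall_of_elemParallel hP hx hx₀ hy).2 y (by simp)

/-- If `J` and `K` are not transverse, the sectors of `K` not containing `J` lie in the sector of
`J` containing `K`. -/
theorem sameSector_of_not_sameSector (hcon : X.Connected) (hJK : J ≠ K) (htr : ¬ Transverse J K)
    {x p q : V} (hp : p ∈ J.carrier) (hq : q ∈ K.carrier) (hx : ¬ K.SameSector x p) :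
    J.SameSector x q := by
  obtain ⟨w⟩ := hcon.preconnected x p
  induction w with
  | nil => exact absurd (.refl K _) hx
  | @cons x y z hadj w ih =>
    by_cases hK : s(x, y) ∈ K.1
    · exact sameSector_of_mem_of_not_transverse hJK htr ⟨y, hK⟩ hq
    · have hxy := SameSector.of_adj hadj hK
      refine (SameSector.of_adj hadj fun hJ => hx ?_).trans (ih hp fun h => hx (hxy.trans h))
      exact sameSector_of_mem_of_not_transverse hJK.symm (fun h => htr h.symm) ⟨y, hJ⟩ hp

/-- If `J` and `K` are transverse, some clique of `K` lies in the carrier of `J`. -/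
theorem exists_clique_subset_carrier (hX : IsQuasiMedian X) (hJK : J ≠ K) (htr : Transverse J K) :
    ∃ C ∈ cliquesIn K, C ⊆ J.carrier := by
  have hcon := hX.connected
  obtain ⟨a, b, c, d, ⟨hab, hbc, hcd, hda, hac, hbd⟩, jab, jcd, kbc, kda⟩ := htr
  obtain ⟨C, hC, hdC, haC⟩ := exists_clique kda
  refine ⟨C, hC, fun q hq => ?_⟩
  by_cases hqa : q = a
  · exact hqa ▸ ⟨b, jab⟩
  by_cases hqd : q = d
  · exact hqd ▸ ⟨c, Sym2.eq_swap ▸ jcd⟩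
  have kaq : s(a, q) ∈ K.1 := hC.2.2 a haC q hq (Ne.symm hqa)
  have kdq : s(d, q) ∈ K.1 := hC.2.2 d hdC q hq (Ne.symm hqd)
  have hbq : q ≠ b := by
    rintro rfl
    exact hJK (eq_of_mem jab kaq)
  have hcq : q ≠ c := by
    rintro rfl
    exact hJK (eq_of_mem jcd (Sym2.eq_swap ▸ kdq))
  have hqb' : ¬ X.Adj q b := fun h => hJK (eq_of_mem (mem_of_triangle jab (adj kaq) h.symm) kaq)
  have hqc' : ¬ X.Adj q c := fun h =>
    hJK (eq_of_mem (mem_of_triangle' jcd h.symm (adj kdq)) kdq)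
  have hac' : ¬ X.Adj a c := fun h => hJK (eq_of_mem (mem_of_triangle' jab h hbc) kbc)
  have e1 := dist_eq_two hcon (adj kaq).symm hab hbq hqb'
  have e2 := dist_eq_two hcon (adj kdq).symm hcd.symm hcq hqc'
  obtain ⟨s, hsb, hsc, hs⟩ := hX.triangle_condition (u := q) hbc (e1.trans e2.symm)
  have hqs : X.Adj q s := SimpleGraph.dist_eq_one_iff_adj.1 (by omega)
  have hsa : a ≠ s := by
    rintro rfl
    exact hac' hsc
  exact ⟨s, Sym2.eq_swap ▸
    mem_of_square ⟨hab, hsb.symm, hqs.symm, (adj kaq).symm, hsa, hbq.symm⟩ jab⟩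

end Hyperplane

end Hyperplanes

/-! ### Groups acting on quasi-median graphs -/

section Action

open scoped Pointwise

variable {V : Type u} {X : SimpleGraph V} {G : Type v} [Group G] [MulAction G V]

namespace Hyperplane

variable {J K : Hyperplane X}

/-- The elements of `G` that map the set of edges of `J` onto itself. -/
def edgeStabilizer (G : Type v) [Group G] [MulAction G V] (J : Hyperplane X) : Subgroup G where
  carrier := {g | ∀ x y : V, s(g • x, g • y) ∈ J.1 ↔ s(x, y) ∈ J.1}
  one_mem' := fun x y => by simp
  mul_mem' := fun {g h} hg hh x y => by rw [mul_smul, mul_smul, hg, hh]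
  inv_mem' := fun {g} hg x y => by rw [← hg, smul_inv_smul, smul_inv_smul]

/-- The elements of `G` that map each sector delimited by `J` onto itself, expressed by saying that
each vertex is in the same sector as its image. -/
def sectorwiseStabilizer (G : Type v) [Group G] [MulAction G V] (J : Hyperplane X) :
    Subgroup G where
  carrier := {g | ∀ x : V, J.SameSector x (g • x)}
  one_mem' := fun x => by simpa using SameSector.refl J x
  mul_mem' := fun {g h} hg hh x => by
    rw [mul_smul]
    exact (hh x).trans (hg _)
  inv_mem' := fun {g} hg x => by
    have := hg (g⁻¹ • x)
    rw [smul_inv_smul] at this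
    exact this.symm

theorem smul_mem_of_smul_mem (hact : ∀ (g : G) (x y : V), X.Adj (g • x) (g • y) ↔ X.Adj x y)
    {g : G} {a b : V} (h : s(a, b) ∈ J.1) (h' : s(g • a, g • b) ∈ K.1) {x y : V}
    (hxy : s(x, y) ∈ J.1) : s(g • x, g • y) ∈ K.1 := by
  refine forall_of_elemParallel (J := J) (P := fun e => Sym2.map (g • ·) e ∈ K.1)
    (fun e f hef => ?_) h h' hxy
  refine mem_iff_of_elemParallel ?_
  cases hef with
  | triangle a b c hab hbc hca =>
    exact .triangle _ _ _ ((hact g _ _).2 hab) ((hact g _ _).2 hbc) ((hact g _ _).2 hca)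
  | square a b c d h =>
    obtain ⟨hab, hbc, hcd, hda, hac, hbd⟩ := h
    exact .square _ _ _ _ ⟨(hact g _ _).2 hab, (hact g _ _).2 hbc, (hact g _ _).2 hcd,
      (hact g _ _).2 hda, (MulAction.injective g).ne hac, (MulAction.injective g).ne hbd⟩

theorem mem_edgeStabilizer (hact : ∀ (g : G) (x y : V), X.Adj (g • x) (g • y) ↔ X.Adj x y)
    {g : G} {a b : V} (h : s(a, b) ∈ J.1) (h' : s(g • a, g • b) ∈ J.1) :
    g ∈ J.edgeStabilizer G := by
  refine fun x y => ⟨fun hxy => ?_, smul_mem_of_smul_mem hact h h'⟩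
  have := smul_mem_of_smul_mem hact (g := g⁻¹) h' (by simpa using h) hxy
  simpa using this

theorem SameSector.smul (hact : ∀ (g : G) (x y : V), X.Adj (g • x) (g • y) ↔ X.Adj x y)
    {g : G} (hg : g ∈ J.edgeStabilizer G) {x y : V} (h : J.SameSector x y) :
    J.SameSector (g • x) (g • y) := by
  let f : X.deleteEdges J.1 →g X.deleteEdges J.1 :=
    ⟨(g • ·), fun {a b} hab => by
      rw [SimpleGraph.deleteEdges_adj] at hab ⊢
      exact ⟨(hact g a b).2 hab.1, fun h' => hab.2 ((hg a b).1 h')⟩⟩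
  exact SimpleGraph.Reachable.map f h

theorem smul_mem_clique {g : G} (hg : g ∈ rotativeStabilizer G J) {C : Set V}
    (hC : C ∈ cliquesIn J) {x : V} (hx : x ∈ C) : g • x ∈ C := by
  have h : g ∈ MulAction.stabilizer G C := by
    simp only [rotativeStabilizer, Subgroup.mem_iInf] at hg
    exact hg C hC
  rw [MulAction.mem_stabilizer_iff] at h
  exact h ▸ Set.smul_mem_smul_set hx

theorem rotativeStabilizer_le_edgeStabilizer
    (hact : ∀ (g : G) (x y : V), X.Adj (g • x) (g • y) ↔ X.Adj x y) :
    rotativeStabilizer G J ≤ J.edgeStabilizer G := by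
  intro g hg
  obtain ⟨a, b, h⟩ := J.exists_edge
  obtain ⟨C, hC, ha, hb⟩ := exists_clique h
  exact mem_edgeStabilizer hact h (hC.2.2 _ (smul_mem_clique hg hC ha) _ (smul_mem_clique hg hC hb)
    ((MulAction.injective g).ne (adj h).ne))

theorem smul_ne (hstab : ∀ x : V, MulAction.stabilizer G x = ⊥) {g : G} (hg : g ≠ 1) (x : V) :
    g • x ≠ x := fun h => hg (by
  rw [← Subgroup.mem_bot, ← hstab x]
  exact h)

theorem mem_smul_of_mem_carrier (hstab : ∀ x : V, MulAction.stabilizer G x = ⊥) {g : G}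
    (hg : g ∈ rotativeStabilizer G J) (hg1 : g ≠ 1) {x : V} (hx : x ∈ J.carrier) :
    s(x, g • x) ∈ J.1 := by
  obtain ⟨y, h⟩ := hx
  obtain ⟨C, hC, hxC, -⟩ := exists_clique h
  exact hC.2.2 _ hxC _ (smul_mem_clique hg hC hxC) (smul_ne hstab hg1 x).symm

/-- A rotation around `J` preserves each hyperplane `K` transverse to `J`: an edge of `K` in a
square with `J` and its image are opposite sides of a square. -/
theorem mem_edgeStabilizer_of_transverse
    (hact : ∀ (g : G) (x y : V), X.Adj (g • x) (g • y) ↔ X.Adj x y)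
    (hstab : ∀ x : V, MulAction.stabilizer G x = ⊥) (hJK : J ≠ K) (htr : Transverse J K) {g : G}
    (hg : g ∈ rotativeStabilizer G J) (hg1 : g ≠ 1) : g ∈ K.edgeStabilizer G := by
  obtain ⟨a, b, c, d, ⟨hab, hbc, hcd, hda, hac, hbd⟩, jab, jcd, kbc, kda⟩ := htr
  have ja := mem_smul_of_mem_carrier hstab hg hg1 ⟨b, jab⟩
  have jd := mem_smul_of_mem_carrier hstab hg hg1 (x := d) ⟨c, Sym2.eq_swap ▸ jcd⟩
  refine mem_edgeStabilizer hact kda ?_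
  have hsq : IsFourCycle X d a (g • a) (g • d) := by
    refine ⟨hda, adj ja, (hact g a d).2 hda.symm, (adj jd).symm, ?_, ?_⟩
    · intro h
      rw [← h] at ja
      exact hJK (eq_of_mem ja (Sym2.eq_swap ▸ kda))
    · intro h
      rw [← h] at jd
      exact hJK (eq_of_mem jd kda)
  rw [Sym2.eq_swap]
  exact mem_of_square hsq kda

/-- A rotation around `J` fixes the sectors delimited by a transverse hyperplane `K`: each of them
contains a vertex of the carrier of `J`. -/
theorem mem_sectorwiseStabilizer_of_transverse (hX : IsQuasiMedian X)
    (hact : ∀ (g : G) (x y : V), X.Adj (g • x) (g • y) ↔ X.Adj x y)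
    (hstab : ∀ x : V, MulAction.stabilizer G x = ⊥) (hJK : J ≠ K) (htr : Transverse J K) {g : G}
    (hg : g ∈ rotativeStabilizer G J) (hg1 : g ≠ 1) : g ∈ K.sectorwiseStabilizer G := by
  intro x
  have hgK := mem_edgeStabilizer_of_transverse hact hstab hJK htr hg hg1
  obtain ⟨C, hC, hCJ⟩ := exists_clique_subset_carrier hX hJK htr
  obtain ⟨c, hc, hxc⟩ := exists_sameSector_mem_clique hX hC x
  have hgc := mem_smul_of_mem_carrier hstab hg hg1 (hCJ hc)
  exact (hxc.trans (.of_adj (adj hgc) fun h => hJK (eq_of_mem hgc h))).trans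
    (hxc.smul hact hgK).symm

/-- Rotations around transverse hyperplanes commute: on a vertex `a` of a square crossed by both,
`g * h` and `h * g` take the same value, namely the vertex completing a square with `a`, `g • a` and
`h • a`. -/
theorem commute_of_transverse (hX : IsQuasiMedian X)
    (hact : ∀ (g : G) (x y : V), X.Adj (g • x) (g • y) ↔ X.Adj x y)
    (hstab : ∀ x : V, MulAction.stabilizer G x = ⊥) (hJK : J ≠ K) (htr : Transverse J K) {g h : G}
    (hg : g ∈ rotativeStabilizer G J) (hg1 : g ≠ 1) (hh : h ∈ rotativeStabilizer G K)
    (hh1 : h ≠ 1) : Commute g h := by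
  have hgK := mem_edgeStabilizer_of_transverse hact hstab hJK htr hg hg1
  have hhJ := mem_edgeStabilizer_of_transverse hact hstab hJK.symm htr.symm hh
    hh1
  obtain ⟨a, b, c, d, ⟨hab, hbc, hcd, hda, hac, hbd⟩, jab, jcd, kbc, kda⟩ := htr
  have kad : s(a, d) ∈ K.1 := Sym2.eq_swap ▸ kda
  have ja := mem_smul_of_mem_carrier hstab hg hg1 ⟨b, jab⟩
  have ka := mem_smul_of_mem_carrier hstab hh hh1 ⟨d, kad⟩
  have jha := mem_smul_of_mem_carrier hstab hg hg1 ⟨h • b, (hhJ a b).2 jab⟩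
  have kga := mem_smul_of_mem_carrier hstab hh hh1 ⟨g • d, (hgK a d).2 kad⟩
  have hne : g • a ≠ h • a := fun e => hJK (eq_of_mem ja (e ▸ ka))
  have hnadj : ¬ X.Adj (g • a) (h • a) := fun e =>
    hJK (eq_of_mem (mem_of_triangle ja (adj ka) e) ka)
  have h1 : a ≠ g • h • a := fun e => by
    rw [← e] at jha
    exact hJK (eq_of_mem jha (Sym2.eq_swap ▸ ka))
  have h2 : a ≠ h • g • a := fun e => by
    rw [← e] at kga
    exact hJK (eq_of_mem ja (Sym2.eq_swap ▸ kga))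
  have key : g • h • a = h • g • a := hX.eq_of_common_adj hnadj hne (adj ja).symm (adj ka).symm
    ((hact g _ _).2 (adj ka)) (adj jha) (adj kga) ((hact h _ _).2 (adj ja)) h1 h2
  have hfix : (h * g)⁻¹ * (g * h) ∈ MulAction.stabilizer G a := by
    rw [MulAction.mem_stabilizer_iff, mul_smul, inv_smul_eq_iff, mul_smul, mul_smul, key]
  rw [hstab a, Subgroup.mem_bot, inv_mul_eq_one] at hfix
  exact hfix.symm

theorem not_sameSector_zpow_smul (hact : ∀ (g : G) (x y : V), X.Adj (g • x) (g • y) ↔ X.Adj x y)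
    {r : G} (hr : r ∈ J.edgeStabilizer G) (hfree : PermutesSectorsFreely J r) {k : ℤ} (hk : k ≠ 0)
    (x : V) : ¬ J.SameSector (r ^ k • x) x := by
  intro h
  have hrk := zpow_mem hr k
  refine hfree k hk _ ⟨(X.deleteEdges J.1).connectedComponentMk x, rfl⟩ ?_
  ext y
  rw [Set.mem_smul_set_iff_inv_smul_mem]
  simp only [SimpleGraph.ConnectedComponent.mem_supp_iff, SimpleGraph.ConnectedComponent.eq]
  constructor
  · intro hy
    have := SameSector.smul hact hrk (x := (r ^ k)⁻¹ • y) (y := x) hy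
    rw [smul_inv_smul] at this
    exact this.trans h
  · intro hy
    have := SameSector.smul hact (inv_mem hrk) (SameSector.trans hy h.symm)
    rwa [inv_smul_smul] at this

theorem finite_setOf_sameSector (hact : ∀ (g : G) (x y : V), X.Adj (g • x) (g • y) ↔ X.Adj x y)
    {r : G} (hr : r ∈ J.edgeStabilizer G) (hfree : PermutesSectorsFreely J r) (x y : V) :
    {k : ℤ | J.SameSector (r ^ k • x) y}.Finite := by
  refine Set.Subsingleton.finite fun k hk l hl => ?_
  by_contra hkl
  refine not_sameSector_zpow_smul hact hr hfree (sub_ne_zero.2 hkl) x ?_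
  have := SameSector.smul hact (zpow_mem hr (-l)) (SameSector.trans hk hl.symm)
  rw [← mul_smul, ← mul_smul, ← zpow_add, ← zpow_add] at this
  simpa [sub_eq_neg_add] using this

/-- For large `n`, the nontrivial powers of `r J ^ n` map no sector of `J` meeting the finite set
`P` to a sector meeting `P`. -/
theorem exists_forall_not_sameSector {𝒥 : Set (Hyperplane X)} (hfin : 𝒥.Finite)
    (hact : ∀ (g : G) (x y : V), X.Adj (g • x) (g • y) ↔ X.Adj x y) (r : 𝒥 → G)
    (hr : ∀ J : 𝒥, r J ∈ J.1.edgeStabilizer G)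
    (hfree : ∀ J : 𝒥, PermutesSectorsFreely J.1 (r J)) {P : Set V} (hP : P.Finite) :
    ∃ N : ℕ, 1 ≤ N ∧ ∀ n : ℕ, N ≤ n → ∀ k : ℤ, k ≠ 0 → ∀ J : 𝒥, ∀ p ∈ P, ∀ q ∈ P,
      ¬ J.1.SameSector ((r J ^ n) ^ k • p) q := by
  have : Finite 𝒥 := hfin
  have hT : (⋃ J : 𝒥, ⋃ p ∈ P, ⋃ q ∈ P, {k : ℤ | J.1.SameSector (r J ^ k • p) q}).Finite :=
    Set.finite_iUnion fun J => hP.biUnion fun p _ => hP.biUnion fun q _ =>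
      finite_setOf_sameSector hact (hr J) (hfree J) p q
  obtain ⟨M, hM⟩ := (hT.image Int.natAbs).bddAbove
  refine ⟨M + 1, by omega, fun n hn k hk J p hp q hq h => ?_⟩
  rw [← zpow_natCast, ← zpow_mul] at h
  have h1 : (n * k : ℤ).natAbs ≤ M := by
    refine hM ⟨_, ?_, rfl⟩
    simp only [Set.mem_iUnion]
    exact ⟨J, p, hp, q, hq, h⟩
  rw [Int.natAbs_mul, Int.natAbs_natCast] at h1
  have h2 : 1 ≤ k.natAbs := Int.natAbs_pos.2 hk
  have h3 : n * 1 ≤ n * k.natAbs := Nat.mul_le_mul_left n h2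
  omega

end Hyperplane

end Action

end QM

/-! ### The ping-pong -/

theorem proposition3p3 {V : Type u} {G : Type v} [Group G] [MulAction G V]
    (X : SimpleGraph V) (hX : QM.IsQuasiMedian X)
    (hact : ∀ (g : G) (x y : V), X.Adj (g • x) (g • y) ↔ X.Adj x y)
    (hstab : ∀ x : V, MulAction.stabilizer G x = ⊥)
    (𝒥 : Set (QM.Hyperplane X)) (hfin : 𝒥.Finite)
    (r : 𝒥 → G)
    (hr_ne : ∀ J : 𝒥, r J ≠ 1)
    (hr_rot : ∀ J : 𝒥, r J ∈ QM.rotativeStabilizer G J.1)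
    (hr_free : ∀ J : 𝒥, QM.PermutesSectorsFreely J.1 (r J)) :
    ∃ N : ℕ, 1 ≤ N ∧ ∀ n : ℕ, N ≤ n →
      ∃ φ : QM.RAAG (QM.crossingGraph 𝒥) ≃*
          Subgroup.closure (Set.range fun J : 𝒥 => r J ^ n),
        ∀ J : 𝒥, (φ (QM.RAAG.of (QM.crossingGraph 𝒥) J) : G) = r J ^ n := by
  open QM Hyperplane in
  obtain ⟨x₀⟩ := hX.connected.nonempty
  have hedge : ∀ J : 𝒥, r J ∈ J.1.edgeStabilizer G := fun J =>
    rotativeStabilizer_le_edgeStabilizer hact (hr_rot J)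
  choose p hp using fun J : 𝒥 => J.1.carrier_nonempty
  -- The base point, together with a point on each hyperplane.
  let P : Set V := insert x₀ (Set.range p)
  have : Finite 𝒥 := hfin
  obtain ⟨N, hN1, hN⟩ := exists_forall_not_sameSector hfin hact r hedge hr_free
    (P := P) ((Set.finite_range p).insert x₀)
  refine ⟨N, hN1, fun n hn => ?_⟩
  have hrel : ∀ w ∈ raagRelators (crossingGraph 𝒥), FreeGroup.lift (fun J => r J ^ n) w = 1 := by
    rintro _ ⟨J, K, ⟨hJK, htr⟩, rfl⟩
    have hcomm : Commute (r J ^ n) (r K ^ n) :=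
      (commute_of_transverse hX hact hstab (fun h => hJK (Subtype.ext h)) htr (hr_rot J) (hr_ne J)
        (hr_rot K) (hr_ne K)).pow_pow n n
    simp only [map_mul, map_inv, FreeGroup.lift_apply_of]
    rw [hcomm.eq, mul_inv_cancel_right, mul_inv_cancel]
  let ψ : RAAG (crossingGraph 𝒥) →* G := PresentedGroup.toGroup hrel
  have hψ : ∀ J, ψ (RAAG.of (crossingGraph 𝒥) J) = r J ^ n := fun J =>
    PresentedGroup.toGroup.of hrel
  -- The ping-pong set of `J`: the union of the sectors of `J` containing no point of `P`.
  let Y : 𝒥 → Set V := fun J => {x | ∀ q ∈ P, ¬ J.1.SameSector x q}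
  have hY : ∀ (J : 𝒥) (k : ℤ), k ≠ 0 → ∀ x, ∀ q ∈ P, J.1.SameSector x q →
      (r J ^ n) ^ k • x ∈ Y J := by
    intro J k hk x q hq hxq q' hq' h
    have := hxq.smul hact (zpow_mem (pow_mem (hedge J) n) k)
    exact hN n hn k hk J q hq q' hq' (this.symm.trans h)
  have hinj : Function.Injective ψ := by
    refine RAAG.injective_of_pingPong ψ Y x₀ ?_ ?_ ?_ ?_
    · exact fun J h => h x₀ (Set.mem_insert _ _) (.refl _ _)
    · intro J k hk
      rw [hψ]
      exact hY J k hk x₀ x₀ (Set.mem_insert _ _) (.refl _ _)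
    · intro J K hJK hadj k hk x hx
      rw [hψ]
      have hne : J.1 ≠ K.1 := fun h => hJK (Subtype.ext h)
      exact hY J k hk x (p K) (Set.mem_insert_of_mem _ ⟨K, rfl⟩)
        (sameSector_of_not_sameSector hX.connected hne (fun h => hadj ⟨hJK, h⟩) (hp J) (hp K)
          (hx _ (Set.mem_insert_of_mem _ ⟨J, rfl⟩)))
    · intro J K hadj k x hx q hq h
      rw [hψ] at h
      have hsec := mem_sectorwiseStabilizer_of_transverse hX hact hstab
        (fun h => hadj.1 (Subtype.ext h)) hadj.2 (hr_rot J) (hr_ne J)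
      exact hx q hq ((zpow_mem (pow_mem hsec n) k x).trans h)
  have hrange : ψ.range = Subgroup.closure (Set.range fun J : 𝒥 => r J ^ n) := by
    rw [MonoidHom.range_eq_map, ← PresentedGroup.closure_range_of, MonoidHom.map_closure,
      ← Set.range_comp]
    congr 2
    funext J
    exact hψ J
  exact ⟨(MonoidHom.ofInjective hinj).trans (MulEquiv.subgroupCongr hrange), hψ⟩
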